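/- \textbf{Signal temporal logic.} A predicate $\mu$ is given by a $C^1$ function $h:\mathbb R^n\to\mathbb R$, and $\mu$ holds at $y$ iff $h(y)\ge 0$; to a negated predicate $\neg\mu$ we assign the predicate function $-h$, so that $\neg\mu$ holds at $y$ iff $-h(y)\ge 0$. Consider the fragment $\psi::=\top\mid\mu\mid\neg\mu\mid\psi'\wedge\psi''$, $\ \phi::=G_{[a,b]}\psi\mid F_{[a,b]}\psi\mid\psi'\,U_{[a,b]}\,\psi''\mid\phi'\wedge\phi''$, with $0\le a\le b<\infty$ and $b>0$. A signal $x$ satisfies $\phi$ ($x\models\phi$) as follows: $x\models G_{[a,b]}\psi$ iff $\psi$ holds at $x(t)$ for all $t\in[a,b]$; $x\models F_{[a,b]}\psi$ iff $\psi$ holds at $x(t)$ for some $t\in[a,b]$; $x\models\psi' U_{[a,b]}\psi''$ iff for some $t\in[a,b]$, $\psi''$ holds at $x(t)$ and $\psi'$ holds at $x(t')$ for all $t'\in[a_*,t]$. Here either $a_*:=0$ for all until operators, or $a_*:=a$ for all until operators; the result holds for each of these two conventions, provided that the same one is used in the conditions below. \textbf{System.} Let $\dot x=f(x,t)+g(x,t)u(x,t)+c(x,t)$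 with $f,c:\mathbb R^n\times\mathbb R_{\ge0}\to\mathbb R^n$ and $g:\mathbb R^n\times\mathbb R_{\ge 0}\to\mathbb R^{n\times m}$ locally Lipschitz in the first and measurable in the second argument, and $\|c\|\le C$. For a vector field $v$ let $F[v](x,t):=\bigcap_{\delta>0}\bigcap_{|N|=0}\overline{\mathrm{co}}\,v(B_\delta(x)\setminus N,t)$; a Filippov solution of $\dot x=v(x,t)$ on $[t_0,t_1]$ is an absolutely continuous $x$ with $\dot x(t)\in F[v](x(t),t)$ for almost every $t$. \textbf{The function $\mathfrak b$.} Let $l=1,\dots,p$ enumerate the occurrences of literals ($\mu$ or $\neg\mu$) in $\phi$, let $h_l$ be the corresponding predicate function and $[a_l,b_l]$ the window of the corresponding temporal operator. Let $\eta>0$ and let $\mathfrak b_1,\dots,\mathfrak b_p$ and $\tilde{\mathfrak b}_1,\dots,\tilde{\mathfrak b}_k$ ($k\ge0$) be continuous functions $\mathbb R^n\times\mathbb R_{\ge0}\to\mathbb R$. Let $\mathfrak o_l(t)=1$ for $t<b_l$, $\mathfrak o_l(t)=0$ for $t\ge b_l$, and $$\mathfrak b(x,t):=-\tfrac1\eta\ln\Big(\sum_{l=1}^p\mathfrak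 o_l(t)e^{-\eta\mathfrak b_l(x,t)}+\sum_{i=1}^k e^{-\eta\tilde{\mathfrak b}_i(x,t)}\Big),\qquad \mathfrak C(t):=\{x:\mathfrak b(x,t)\ge0\}.$$ Suppose that $\mathfrak b$ satisfies the conditions of Steps A, B, C, that is: for each $G_{[a,b]}\psi$ in $\phi$, $\mathfrak b_l(\cdot,t)\le h_l$ on $\mathbb R^n$ for all $t\in[a,b]$ and all literals $l$ of $\psi$; for each $F_{[a,b]}\psi$ in $\phi$ there is one $t\in[a,b]$ with $\mathfrak b_l(\cdot,t)\le h_l$ for all literals $l$ of $\psi$; for each $\psi'U_{[a,b]}\psi''$ in $\phi$ there is one $t\in[a,b]$ with $\mathfrak b_l(\cdot,t)\le h_l$ for all literals $l$ of $\psi''$ and $\mathfrak b_l(\cdot,t')\le h_l$ for all $t'\in[a_*,t]$ and all literals $l$ of $\psi'$. Let $0=s_0<s_1<\dots<s_q$ be the elements of $\{0,b_1,\dots,b_p\}$. Suppose that for every $j<q$: $\mathfrak b$ is $C^1$ on $\mathbb R^n\times(s_j,s_{j+1})$; $\mathfrak b$ is a candidate control barrier function for $[s_j,s_{j+1})$,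 i.e. for each $x_0\in\mathfrak C(s_j)$ there is an absolutely continuous $x:[s_j,s_{j+1})\to\mathbb R^n$ with $x(s_j)=x_0$ and $x(t)\in\mathfrak C(t)$ for all $t$; and there are an open set $\mathfrak D_j$ and a compact set $\mathfrak D_j'\subset\mathfrak D_j$ with $\mathfrak C(t)\subset\mathfrak D_j'$ for all $t\in[s_j,s_{j+1})$. \textbf{Claim.} Suppose that $u:\mathbb R^n\times\mathbb R_{\ge0}\to\mathbb R^m$ is locally bounded and measurable and that for each $j<q$ there is a locally Lipschitz continuous extended class $\mathcal K$ function $\alpha_j:\mathbb R\to\mathbb R$ (strictly increasing, $\alpha_j(0)=0$) with $$\min_{\zeta\in F[f+gu](x,t)}\Big(\frac{\partial\mathfrak b(x,t)}{\partial x}\zeta+\frac{\partial\mathfrak b(x,t)}{\partial t}\Big)\ge-\alpha_j(\mathfrak b(x,t))+\Big\|\frac{\partial\mathfrak b(x,t)}{\partial x}\Big\|C\quad\text{for all }(x,t)\in\mathfrak D_j\times(s_j,s_{j+1}).$$ Then $x\models\phi$ for each Filippov solution $x:[0,t_1]\to\mathbb R^n$ of the system with $x(0)\in\mathfrak C(0)$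 and $t_1\ge s_q$. Moreover, if the right-hand side $f+gu+c$ is locally bounded on $\mathbb R^n\times\mathbb R_{\ge0}$, then each Filippov solution on some $[0,t_1]$, $t_1\ge0$, with $x(0)\in\mathfrak C(0)$ can be continued to a Filippov solution on an interval $[0,t_2]$ with $t_2\ge s_q$, and this solution satisfies $\phi$. -/

import Mathlib

open Set Filter Topology MeasureTheory

noncomputable section

namespace STLBarrier

/-- The Euclidean space `ℝⁿ`. -/
abbrev Vec (n : ℕ) : Type := EuclideanSpace ℝ (Fin n)

/-! ### Signal temporal logic -/

/-- A predicate `μ`, given by its continuously differentiable predicate function `h`;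
`μ` holds at a state `y` if and only if `0 ≤ h y`. -/
structure Predicate (n : ℕ) where
  h : Vec n → ℝ
  contDiff : ContDiff ℝ 1 h

/-- A time window `[a, b]` of a temporal operator, `0 ≤ a ≤ b < ∞`. The window `{0}` is excluded. -/
structure Window where
  a : ℝ
  b : ℝ
  a_nonneg : 0 ≤ a
  a_le_b : a ≤ b
  b_pos : 0 < b

/-- The class `ψ ::= ⊤ | μ | ¬ μ | ψ' ∧ ψ''`. -/
inductive StateFormula (n : ℕ) : Type
  | top : StateFormula n
  | pred (μ : Predicate n) : StateFormula n
  | negPred (μ : Predicate n) : StateFormula n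
  | and (ψ₁ ψ₂ : StateFormula n) : StateFormula n

/-- The class `φ ::= G_[a,b] ψ | F_[a,b] ψ | ψ' U_[a,b] ψ'' | φ' ∧ φ''`. -/
inductive Formula (n : ℕ) : Type
  | always (w : Window) (ψ : StateFormula n) : Formula n
  | eventually (w : Window) (ψ : StateFormula n) : Formula n
  | until (w : Window) (ψ₁ ψ₂ : StateFormula n) : Formula n
  | and (φ₁ φ₂ : Formula n) : Formula n

/-- The two conventions for the times at which the left argument of `ψ' U_[a,b] ψ''`, evaluated
at time `t`, has to hold: from the evaluation time `t` on, or from the beginning `t + a` of the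
window on (in both cases up to and including the time at which `ψ''` holds). -/
inductive UntilStart : Type
  | evaluationTime : UntilStart
  | windowStart : UntilStart

/-- The offset, relative to the evaluation time, from which the left argument of an until operator
with window `w` has to hold. -/
def UntilStart.offset : UntilStart → Window → ℝ
  | .evaluationTime, _ => 0
  | .windowStart, w => w.a

/-- Satisfaction of a state formula at a state. The predicate function of `¬ μ` is `-h`, so `¬ μ`
holds at `y` if and only if `0 ≤ -h y`. -/
def StateFormula.Sat {n : ℕ} : StateFormula n → Vec n → Prop
  | .top, _ => True
  | .pred μ, y => 0 ≤ μ.h y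
  | .negPred μ, y => 0 ≤ -μ.h y
  | .and ψ₁ ψ₂, y => ψ₁.Sat y ∧ ψ₂.Sat y

/-- `φ.SatAt σ x t`: the signal `x` satisfies `φ` at time `t`. -/
def Formula.SatAt {n : ℕ} (σ : UntilStart) : Formula n → (ℝ → Vec n) → ℝ → Prop
  | .always w ψ, x, t => ∀ τ ∈ Icc (t + w.a) (t + w.b), ψ.Sat (x τ)
  | .eventually w ψ, x, t => ∃ τ ∈ Icc (t + w.a) (t + w.b), ψ.Sat (x τ)
  | .until w ψ₁ ψ₂, x, t => ∃ τ ∈ Icc (t + w.a) (t + w.b),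
      ψ₂.Sat (x τ) ∧ ∀ τ' ∈ Icc (t + σ.offset w) τ, ψ₁.Sat (x τ')
  | .and φ₁ φ₂, x, t => φ₁.SatAt σ x t ∧ φ₂.SatAt σ x t

/-- `x ⊨ φ`: satisfaction at time `0`. -/
def Formula.Sat {n : ℕ} (σ : UntilStart) (φ : Formula n) (x : ℝ → Vec n) : Prop :=
  φ.SatAt σ x 0

/-! ### The functions `𝔟_l` attached to a formula -/

/-- The occurrences of literals (`μ` or `¬ μ`) in a state formula. -/
def StateFormula.Idx {n : ℕ} : StateFormula n → Type
  | .top => Empty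
  | .pred _ => Unit
  | .negPred _ => Unit
  | .and ψ₁ ψ₂ => ψ₁.Idx ⊕ ψ₂.Idx

/-- The occurrences of literals in a formula; each of them carries one function `𝔟_l`. -/
def Formula.Idx {n : ℕ} : Formula n → Type
  | .always _ ψ => ψ.Idx
  | .eventually _ ψ => ψ.Idx
  | .until _ ψ₁ ψ₂ => ψ₁.Idx ⊕ ψ₂.Idx
  | .and φ₁ φ₂ => φ₁.Idx ⊕ φ₂.Idx

def StateFormula.fintypeIdx {n : ℕ} : (ψ : StateFormula n) → Fintype ψ.Idx
  | .top => inferInstanceAs (Fintype Empty)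
  | .pred _ => inferInstanceAs (Fintype Unit)
  | .negPred _ => inferInstanceAs (Fintype Unit)
  | .and ψ₁ ψ₂ =>
    letI := ψ₁.fintypeIdx
    letI := ψ₂.fintypeIdx
    inferInstanceAs (Fintype (ψ₁.Idx ⊕ ψ₂.Idx))

instance {n : ℕ} (ψ : StateFormula n) : Fintype ψ.Idx := ψ.fintypeIdx

def Formula.fintypeIdx {n : ℕ} : (φ : Formula n) → Fintype φ.Idx
  | .always _ ψ => inferInstanceAs (Fintype ψ.Idx)
  | .eventually _ ψ => inferInstanceAs (Fintype ψ.Idx)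
  | .until _ ψ₁ ψ₂ => inferInstanceAs (Fintype (ψ₁.Idx ⊕ ψ₂.Idx))
  | .and φ₁ φ₂ =>
    letI := φ₁.fintypeIdx
    letI := φ₂.fintypeIdx
    inferInstanceAs (Fintype (φ₁.Idx ⊕ φ₂.Idx))

instance {n : ℕ} (φ : Formula n) : Fintype φ.Idx := φ.fintypeIdx

/-- The predicate function of a literal: `h` for `μ` and `-h` for `¬ μ`. -/
def StateFormula.predFun {n : ℕ} : (ψ : StateFormula n) → ψ.Idx → Vec n → ℝ
  | .top => fun l _ => l.elim
  | .pred μ => fun _ y => μ.h y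
  | .negPred μ => fun _ y => -μ.h y
  | .and ψ₁ ψ₂ => Sum.elim ψ₁.predFun ψ₂.predFun

/-- The right end point `b_l` of the window of the temporal operator to which `l` belongs. -/
def Formula.endTime {n : ℕ} : (φ : Formula n) → φ.Idx → ℝ
  | .always w _ => fun _ => w.b
  | .eventually w _ => fun _ => w.b
  | .until w _ _ => fun _ => w.b
  | .and φ₁ φ₂ => Sum.elim φ₁.endTime φ₂.endTime

/-- At time `t`, each `𝔟_l` lies below the predicate function of its literal. -/
def StateFormula.Below {n : ℕ} (ψ : StateFormula n) (β : ψ.Idx → Vec n → ℝ → ℝ) (t : ℝ) : Prop :=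
  ∀ l y, β l y t ≤ ψ.predFun l y

/-- The conditions on the functions `𝔟_l` (Steps A, B and C). -/
def Formula.Steps {n : ℕ} (σ : UntilStart) :
    (φ : Formula n) → (φ.Idx → Vec n → ℝ → ℝ) → Prop
  | .always w ψ, β => ∀ t ∈ Icc w.a w.b, ψ.Below β t
  | .eventually w ψ, β => ∃ t ∈ Icc w.a w.b, ψ.Below β t
  | .until w ψ₁ ψ₂, β => ∃ t ∈ Icc w.a w.b,
      ψ₂.Below (fun l => β (Sum.inr l)) t ∧
        ∀ t' ∈ Icc (σ.offset w) t, ψ₁.Below (fun l => β (Sum.inl l)) t'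
  | .and φ₁ φ₂, β =>
      φ₁.Steps σ (fun l => β (Sum.inl l)) ∧ φ₂.Steps σ (fun l => β (Sum.inr l))

/-- The switching function `𝔬_l`: `1` before the end of the window, `0` afterwards. -/
def Formula.active {n : ℕ} (φ : Formula n) (l : φ.Idx) (t : ℝ) : ℝ :=
  if t < φ.endTime l then 1 else 0

/-- `𝔟(y,t) = -(1/η) ln (∑ₗ 𝔬_l(t) exp (-η 𝔟_l(y,t)))`. The functions `γ` are further functions,
not related to a literal and never switched off (for instance one that keeps the sets `ℭ(t)`
bounded); `k = 0` is allowed. -/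
def barrier {n k : ℕ} (φ : Formula n) (η : ℝ) (β : φ.Idx → Vec n → ℝ → ℝ)
    (γ : Fin k → Vec n → ℝ → ℝ) (y : Vec n) (t : ℝ) : ℝ :=
  -(1 / η) * Real.log
    ((∑ l, φ.active l t * Real.exp (-η * β l y t)) + ∑ i, Real.exp (-η * γ i y t))

/-- `s 0 = 0 < s 1 < ⋯ < s q` are the switching times: `0` and the points `b_l`, in increasing
order. -/
structure Formula.IsSwitchingSequence {n : ℕ} (φ : Formula n) (q : ℕ) (s : ℕ → ℝ) : Prop where
  zero : s 0 = 0
  strictMono : StrictMonoOn s (Iic q)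
  image : s '' Iic q = insert 0 (range φ.endTime)

/-! ### Control barrier functions -/

/-- The superlevel set `ℭ(t)`. -/
def safeSet {n : ℕ} (b : Vec n → ℝ → ℝ) (t : ℝ) : Set (Vec n) := {y | 0 ≤ b y t}

/-- `b` is a candidate control barrier function for `[s, s')`. -/
def IsCandidateCBF {n : ℕ} (b : Vec n → ℝ → ℝ) (s s' : ℝ) : Prop :=
  ∀ x₀ ∈ safeSet b s, ∃ x : ℝ → Vec n,
    (∀ T ∈ Ico s s', AbsolutelyContinuousOnInterval x s T) ∧ x s = x₀ ∧
      ∀ t ∈ Ico s s', x t ∈ safeSet b t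

/-- Extended class `𝒦` functions. -/
def IsExtendedClassK (α : ℝ → ℝ) : Prop :=
  Continuous α ∧ StrictMono α ∧ α 0 = 0

/-! ### Filippov solutions -/

/-- Filippov's set-valued map `F[v](x,t)`: the convexification of the essential values of
`v(·,t)` at `x`. -/
def filippovMap {n : ℕ} (v : Vec n → ℝ → Vec n) (x : Vec n) (t : ℝ) : Set (Vec n) :=
  ⋂ (δ : ℝ) (_ : 0 < δ) (N : Set (Vec n)) (_ : volume N = 0),
    closure (convexHull ℝ ((fun y => v y t) '' (Metric.ball x δ \ N)))

/-- `x` is a Filippov solution of `ẋ = v(x,t)` on `[t₀, t₁]`. -/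
def IsFilippovSolution {n : ℕ} (v : Vec n → ℝ → Vec n) (x : ℝ → Vec n) (t₀ t₁ : ℝ) : Prop :=
  AbsolutelyContinuousOnInterval x t₀ t₁ ∧
    ∀ᵐ t ∂(volume.restrict (Icc t₀ t₁)), ∃ ζ ∈ filippovMap v (x t) t, HasDerivAt x ζ t

/-- The set-valued Lie derivative `{∂b/∂x · ζ + ∂b/∂t | ζ ∈ F[v](x,t)}`. -/
def lieDerivative {n : ℕ} (v : Vec n → ℝ → Vec n) (b : Vec n → ℝ → ℝ) (x : Vec n) (t : ℝ) :
    Set ℝ :=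
  {r | ∃ ζ ∈ filippovMap v x t,
    r = fderiv ℝ (fun y => b y t) x ζ + deriv (fun τ => b x τ) t}

/-- Sufficient regularity of a function on `ℝⁿ × ℝ≥0`: locally Lipschitz continuous in the first
argument and Lebesgue measurable in the second one. -/
def SufficientlyRegular {n : ℕ} {F : Type} [NormedAddCommGroup F] [MeasurableSpace F]
    (v : Vec n → ℝ → F) : Prop :=
  (∀ t, 0 ≤ t → LocallyLipschitz fun x => v x t) ∧
    ∀ x, AEMeasurable (fun t => v x t) (volume.restrict (Ici 0))

/-- Local boundedness of a function on `ℝⁿ × ℝ≥0`. -/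
def LocBounded {n : ℕ} {F : Type} [NormedAddCommGroup F] (v : Vec n → ℝ → F) : Prop :=
  ∀ x t, 0 ≤ t → ∃ M : ℝ, ∀ᶠ p in 𝓝[univ ×ˢ Ici 0] ((x, t) : Vec n × ℝ), ‖v p.1 p.2‖ ≤ M

/-- Lebesgue measurability of a function on `ℝⁿ × ℝ≥0`. -/
def LebesgueMeasurable {n : ℕ} {F : Type} [MeasurableSpace F] (v : Vec n → ℝ → F) : Prop :=
  AEMeasurable (fun p : Vec n × ℝ => v p.1 p.2) (volume.restrict (univ ×ˢ Ici 0))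

end STLBarrier

end

/-! Invariance. Inside a switching interval `t ↦ b (x t) t` is absolutely continuous on compact
subintervals. Where `b < 0` and the curve lies in `D j`, the term `-α j b` is nonnegative and the
perturbation costs at most `‖∂b/∂x‖ C`, so the derivative is nonnegative almost everywhere. A
function that does not decrease while negative cannot become negative (`nonneg_of_barrier`). At a
switching time, positive terms are dropped from the exponential sum, so the sum can only shrink and
its bound by `1` survives (`barrier_nonneg_succ`).

Satisfaction. If `b ≥ 0`, the sum is at most `1`, hence so is each active summand `exp (-η β_l)`,
and `β_l ≥ 0`. Continuity adds the end of each window, and Steps A, B, C turn `β_l ≥ 0` into `h_l ≥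
0`.

Continuation. The right-hand side is cut off outside a ball containing all `D' j`. Euler curves for
its averages over small balls converge to a Filippov solution of the bounded problem
(`exists_filippov_solution`), which is glued to the given curve. The result solves the original
inclusion as long as it stays in the ball, and invariance needs no more than that to show that it
does not leave the ball before `s q`. -/

/-! ### Absolutely continuous curves and the barrier argument. -/

theorem hasDerivAt_comp_curve {E : Type*} [NormedAddCommGroup E] [NormedSpace ℝ E]
    {b : E → ℝ → ℝ} {U : Set (E × ℝ)} (hU : IsOpen U)
    (hb : ContDiffOn ℝ 1 (fun p : E × ℝ => b p.1 p.2) U) {x : ℝ → E} {ζ : E} {t : ℝ}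
    (hmem : (x t, t) ∈ U) (hx : HasDerivAt x ζ t) :
    HasDerivAt (fun τ => b (x τ) τ)
      (fderiv ℝ (fun y => b y t) (x t) ζ + deriv (fun τ => b (x t) τ) t) t := by
  have hB := ((hb.differentiableOn one_ne_zero _ hmem).differentiableAt
    (hU.mem_nhds hmem)).hasFDerivAt
  set L := fderiv ℝ (fun p : E × ℝ => b p.1 p.2) (x t, t)
  have e1 : HasFDerivAt (fun y => b y t) (L.comp (ContinuousLinearMap.inl ℝ E ℝ)) (x t) :=
    hB.comp (f := fun y => (y, t)) (x t) (hasFDerivAt_prodMk_left (x t) t)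
  have e2 : HasDerivAt (fun τ => b (x t) τ) (L (0, 1)) t :=
    hB.comp_hasDerivAt (f := fun τ => (x t, τ)) t
      ((hasDerivAt_const t (x t)).prodMk (hasDerivAt_id t))
  have e3 : HasDerivAt (fun τ => b (x τ) τ) (L (ζ, 1)) t :=
    hB.comp_hasDerivAt (f := fun τ => (x τ, τ)) t (hx.prodMk (hasDerivAt_id t))
  rw [e1.fderiv, e2.deriv]
  convert e3 using 1
  rw [ContinuousLinearMap.comp_apply, ← map_add]
  simp

namespace AbsolutelyContinuousOnInterval

theorem lipschitzOnWith_comp {X Y : Type*} [PseudoMetricSpace X] [PseudoMetricSpace Y]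
    {f : ℝ → X} {g : X → Y} {a b : ℝ} {K : NNReal} (hf : AbsolutelyContinuousOnInterval f a b)
    (hg : LipschitzOnWith K g (f '' uIcc a b)) :
    AbsolutelyContinuousOnInterval (fun t => g (f t)) a b := by
  have h0 : Tendsto (fun E : ℕ × (ℕ → ℝ × ℝ) =>
      (K : ℝ) * ∑ i ∈ Finset.range E.1, dist (f (E.2 i).1) (f (E.2 i).2))
      (totalLengthFilter ⊓ 𝓟 (disjWithin a b)) (𝓝 0) := by
    simpa using Tendsto.const_mul (K : ℝ) hf
  refine squeeze_zero' (Eventually.of_forall fun E => Finset.sum_nonneg fun i _ => dist_nonneg)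
    ?_ h0
  filter_upwards [mem_inf_of_right (mem_principal_self _)] with E hE
  rw [Finset.mul_sum]
  exact Finset.sum_le_sum fun i hi =>
    hg.dist_le_mul _ (mem_image_of_mem f (hE.1 i hi).1) _ (mem_image_of_mem f (hE.1 i hi).2)

theorem prodMk {X Y : Type*} [PseudoMetricSpace X] [PseudoMetricSpace Y]
    {f : ℝ → X} {g : ℝ → Y} {a b : ℝ} (hf : AbsolutelyContinuousOnInterval f a b)
    (hg : AbsolutelyContinuousOnInterval g a b) :
    AbsolutelyContinuousOnInterval (fun t => (f t, g t)) a b := by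
  refine squeeze_zero (fun E => Finset.sum_nonneg fun i _ => dist_nonneg) (fun E => ?_)
    (by simpa using Tendsto.add hf hg)
  rw [← Finset.sum_add_distrib]
  exact Finset.sum_le_sum fun i _ =>
    (Prod.dist_eq ..).trans_le (max_le_add_of_nonneg dist_nonneg dist_nonneg)

/-- A `C¹` map is locally Lipschitz, hence Lipschitz on the compact image of the curve. -/
theorem contDiffOn_comp {E F : Type*} [NormedAddCommGroup E] [NormedSpace ℝ E]
    [NormedAddCommGroup F] [NormedSpace ℝ F] {f : ℝ → E} {g : E → F} {U : Set E} {a b : ℝ}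
    (hf : AbsolutelyContinuousOnInterval f a b) (hU : IsOpen U) (hg : ContDiffOn ℝ 1 g U)
    (hmem : ∀ t ∈ uIcc a b, f t ∈ U) :
    AbsolutelyContinuousOnInterval (fun t => g (f t)) a b := by
  have hsub : f '' uIcc a b ⊆ U := by rintro _ ⟨t, ht, rfl⟩; exact hmem t ht
  have hloc : LocallyLipschitzOn (f '' uIcc a b) g := fun x hx => by
    obtain ⟨K, t, ht, hK⟩ :=
      ((hg x (hsub hx)).contDiffAt (hU.mem_nhds (hsub hx))).exists_lipschitzOnWith
    exact ⟨K, t, mem_nhdsWithin_of_mem_nhds ht, hK⟩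
  obtain ⟨K, hK⟩ := hloc.exists_lipschitzOnWith_of_compact
    (isCompact_uIcc.image_of_continuousOn hf.continuousOn)
  exact hf.lipschitzOnWith_comp hK

theorem le_of_ae_deriv_nonneg {f : ℝ → ℝ} {a b : ℝ} (hab : a ≤ b)
    (hf : AbsolutelyContinuousOnInterval f a b)
    (h : ∀ᵐ t, t ∈ Ioo a b → 0 ≤ deriv f t) : f a ≤ f b := by
  have h1 := hf.integral_deriv_eq_sub
  have h2 : 0 ≤ ∫ t in a..b, deriv f t := by
    refine intervalIntegral.integral_nonneg_of_ae_restrict hab ?_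
    rw [← restrict_Ioo_eq_restrict_Icc]
    exact (ae_restrict_iff' measurableSet_Ioo).2 h
  linarith

/-- A function that does not decrease while the curve stays in `D` and the function is negative
cannot become negative, if its superlevel sets lie in the open set `D`. -/
theorem nonneg_of_barrier {E : Type*} [NormedAddCommGroup E] [NormedSpace ℝ E]
    {b : E → ℝ → ℝ} {D : Set E} (hD : IsOpen D) {a c : ℝ}
    (hcont : ContinuousOn (fun p : E × ℝ => b p.1 p.2) (univ ×ˢ Ico a c))
    (hdiff : ContDiffOn ℝ 1 (fun p : E × ℝ => b p.1 p.2) (univ ×ˢ Ioo a c))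
    (hsub : ∀ t ∈ Ico a c, ∀ y, 0 ≤ b y t → y ∈ D)
    {x : ℝ → E} {T : ℝ} (hx : AbsolutelyContinuousOnInterval x a T) (hTc : T < c)
    (hderiv : ∀ᵐ t, t ∈ Ioo a T → x t ∈ D → b (x t) t < 0 → ∃ ζ, HasDerivAt x ζ t ∧
      0 ≤ fderiv ℝ (fun y => b y t) (x t) ζ + deriv (fun τ => b (x t) τ) t)
    (haT : a ≤ T) (h0 : 0 ≤ b (x a) a) : 0 ≤ b (x T) T := by
  by_contra! hneg
  have hxc : ContinuousOn x (Icc a T) := by simpa [uIcc_of_le haT] using hx.continuousOn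
  have hhc : ContinuousOn (fun t => b (x t) t) (Icc a T) :=
    hcont.comp (f := fun t => (x t, t)) (hxc.prodMk continuousOn_id)
      fun t ht => ⟨mem_univ _, ht.1, ht.2.trans_lt hTc⟩
  -- The last time `t₀` with `b ≥ 0`. Just after it `b` is negative while the curve is still in the
  -- open set `D`, so `b` does not decrease there, which is a contradiction.
  set S : Set ℝ := Icc a T ∩ (fun t => b (x t) t) ⁻¹' Ici 0 with hS
  have hSc : IsCompact S := isCompact_Icc.of_isClosed_subset
    (hhc.preimage_isClosed_of_isClosed isClosed_Icc isClosed_Ici) inter_subset_left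
  obtain ⟨t₀, ht₀⟩ := hSc.exists_isGreatest ⟨a, ⟨le_rfl, haT⟩, h0⟩
  obtain ⟨⟨⟨hat, htT⟩, hb0 : 0 ≤ b (x t₀) t₀⟩, hmax⟩ := ht₀
  have hltT : t₀ < T := htT.lt_of_ne (by rintro rfl; exact absurd hb0 hneg.not_ge)
  have hafter : ∀ t ∈ Ioc t₀ T, b (x t) t < 0 := fun t ht => by
    by_contra! h
    exact absurd (hmax ⟨⟨hat.trans ht.1.le, ht.2⟩, h⟩) ht.1.not_ge
  have hxD : x t₀ ∈ D := hsub t₀ ⟨hat, htT.trans_lt hTc⟩ _ hb0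
  have hev : ∀ᶠ t in 𝓝[>] t₀, x t ∈ D ∧ t < T := by
    refine Eventually.and ?_ (mem_nhdsWithin_of_mem_nhds (Iio_mem_nhds hltT))
    have h1 : ContinuousWithinAt x (Ici t₀ ∩ Iic T) t₀ :=
      (hxc t₀ ⟨hat, htT⟩).mono fun t ht => ⟨hat.trans ht.1, ht.2⟩
    have h2 := h1 (hD.mem_nhds hxD)
    have h3 : 𝓝[>] t₀ ≤ 𝓝[Ici t₀ ∩ Iic T] t₀ := by
      rw [nhdsWithin_inter_of_mem' (mem_nhdsWithin_of_mem_nhds (Iic_mem_nhds hltT))]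
      exact nhdsWithin_mono _ Ioi_subset_Ici_self
    exact h3 h2
  obtain ⟨r, hr, hrsub⟩ := mem_nhdsGT_iff_exists_Ioo_subset.1 hev
  have hxDT : ∀ t, t₀ < t → t < r → x t ∈ D ∧ t < T := fun t h1 h2 => by
    have h3 : t ∈ {t | x t ∈ D ∧ t < T} := hrsub (mem_Ioo.2 ⟨h1, h2⟩)
    exact h3
  obtain ⟨d, hd1, hd2⟩ := exists_between (mem_Ioi.1 hr)
  obtain ⟨-, hdT⟩ := hxDT d hd1 hd2
  -- Smoothness is available only on the open interval and `t₀ = a` is possible; hence the start at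
  -- `e > t₀`, followed by the limit `e → t₀`.
  have hmono : ∀ e ∈ Ioo t₀ d, b (x e) e ≤ b (x d) d := fun e he => by
    have hAC : AbsolutelyContinuousOnInterval (fun t => b (x t) t) e d := by
      have hxe : AbsolutelyContinuousOnInterval x e d := hx.mono (by
        rw [uIcc_of_le he.2.le, uIcc_of_le haT]
        exact Icc_subset_Icc (hat.trans he.1.le) hdT.le)
      have hid : AbsolutelyContinuousOnInterval (fun t : ℝ => t) e d :=
        (LipschitzWith.id.lipschitzOnWith).absolutelyContinuousOnInterval
      have hpair : AbsolutelyContinuousOnInterval (fun t => (x t, t)) e d := prodMk hxe hid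
      refine contDiffOn_comp (g := fun p : E × ℝ => b p.1 p.2) (U := univ ×ˢ Ioo a c)
        (f := fun t => (x t, t)) hpair (isOpen_univ.prod isOpen_Ioo) hdiff fun t ht => ?_
      rw [uIcc_of_le he.2.le] at ht
      exact ⟨mem_univ _, (hat.trans_lt he.1).trans_le ht.1, (ht.2.trans_lt hdT).trans hTc⟩
    refine hAC.le_of_ae_deriv_nonneg he.2.le ?_
    filter_upwards [hderiv] with t ht hte
    have htd : t₀ < t := he.1.trans hte.1
    obtain ⟨ζ, hζ, hpos⟩ := ht ⟨hat.trans_lt htd, hte.2.trans hdT⟩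
      (hxDT t htd (hte.2.trans hd2)).1 (hafter t ⟨htd, (hte.2.trans hdT).le⟩)
    rwa [(hasDerivAt_comp_curve (isOpen_univ.prod isOpen_Ioo) hdiff
      ⟨mem_univ _, hat.trans_lt htd, (hte.2.trans hdT).trans hTc⟩ hζ).deriv]
  have hlim : b (x t₀) t₀ ≤ b (x d) d := by
    have h1 : Tendsto (fun t => b (x t) t) (𝓝[>] t₀) (𝓝 (b (x t₀) t₀)) := by
      have h2 : ContinuousWithinAt (fun t => b (x t) t) (Icc a T) t₀ := hhc t₀ ⟨hat, htT⟩
      refine h2.tendsto.mono_left ?_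
      rw [← nhdsWithin_Ioo_eq_nhdsGT hltT]
      exact nhdsWithin_mono _ fun t ht => ⟨hat.trans ht.1.le, ht.2.le⟩
    refine le_of_tendsto h1 ?_
    filter_upwards [Ioo_mem_nhdsGT hd1] with e he using hmono e he
  exact absurd (hb0.trans hlim) (hafter d ⟨hd1, hdT.le⟩).not_ge

end AbsolutelyContinuousOnInterval

/-! ### Formulas, switching and forward invariance. -/

noncomputable section

namespace STLBarrier

theorem StateFormula.sat_of_below {n : ℕ} (ψ : StateFormula n) (β : ψ.Idx → Vec n → ℝ → ℝ)
    {t : ℝ} {y : Vec n} (hβ : ψ.Below β t) (h : ∀ l, 0 ≤ β l y t) : ψ.Sat y := by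
  induction ψ with
  | top => trivial
  | pred μ => exact (h ()).trans (hβ () y)
  | negPred μ => exact (h ()).trans (hβ () y)
  | and ψ₁ ψ₂ ih₁ ih₂ =>
    exact ⟨ih₁ (fun l => β (Sum.inl l)) (fun l => hβ (Sum.inl l)) fun l => h (Sum.inl l),
      ih₂ (fun l => β (Sum.inr l)) (fun l => hβ (Sum.inr l)) fun l => h (Sum.inr l)⟩

theorem UntilStart.offset_nonneg (σ : UntilStart) (w : Window) : 0 ≤ σ.offset w := by
  cases σ
  · exact le_rfl
  · exact w.a_nonneg

theorem Formula.sat_of_steps {n : ℕ} (σ : UntilStart) (φ : Formula n)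
    (β : φ.Idx → Vec n → ℝ → ℝ) (hβ : φ.Steps σ β) (x : ℝ → Vec n)
    (h : ∀ l, ∀ t ∈ Icc 0 (φ.endTime l), 0 ≤ β l (x t) t) : φ.Sat σ x := by
  induction φ with
  | always w ψ =>
    intro t ht
    rw [zero_add, zero_add] at ht
    exact ψ.sat_of_below β (hβ t ht) fun l => h l t ⟨w.a_nonneg.trans ht.1, ht.2⟩
  | eventually w ψ =>
    obtain ⟨t, ht, hbelow⟩ := hβ
    exact ⟨t, by rwa [zero_add, zero_add],
      ψ.sat_of_below β hbelow fun l => h l t ⟨w.a_nonneg.trans ht.1, ht.2⟩⟩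
  | and φ₁ φ₂ ih₁ ih₂ =>
    exact ⟨ih₁ _ hβ.1 fun l => h (Sum.inl l), ih₂ _ hβ.2 fun l => h (Sum.inr l)⟩
  | _ w ψ₁ ψ₂ =>
    obtain ⟨t, ht, hbelow, hbelow'⟩ := hβ
    refine ⟨t, by rwa [zero_add, zero_add], ψ₂.sat_of_below _ hbelow
      fun l => h (Sum.inr l) t ⟨w.a_nonneg.trans ht.1, ht.2⟩, fun t' ht' => ?_⟩
    rw [zero_add] at ht'
    exact ψ₁.sat_of_below _ (hbelow' t' ht') fun l =>
      h (Sum.inl l) t' ⟨(σ.offset_nonneg w).trans ht'.1, ht'.2.trans ht.2⟩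

/-- Ensures that the end of a window is a limit of earlier times, at which the literal is still
active; the window `{0}` would leave no such times. -/
theorem Formula.endTime_pos {n : ℕ} (φ : Formula n) (l : φ.Idx) : 0 < φ.endTime l := by
  induction φ with
  | always w ψ => exact w.b_pos
  | eventually w ψ => exact w.b_pos
  | and φ₁ φ₂ ih₁ ih₂ =>
    cases l with
    | inl l => exact ih₁ l
    | inr l => exact ih₂ l
  | _ w ψ₁ ψ₂ => exact w.b_pos

namespace Formula.IsSwitchingSequence

variable {n : ℕ} {φ : Formula n} {q : ℕ} {s : ℕ → ℝ}

theorem lt_succ (hs : φ.IsSwitchingSequence q s) {j : ℕ} (hj : j < q) : s j < s (j + 1) :=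
  hs.strictMono hj.le (Nat.succ_le_of_lt hj) j.lt_succ_self

theorem nonneg (hs : φ.IsSwitchingSequence q s) {j : ℕ} (hj : j ≤ q) : 0 ≤ s j := by
  rw [← hs.zero]
  exact hs.strictMono.monotoneOn (mem_Iic.2 q.zero_le) hj j.zero_le

theorem exists_endTime_eq (hs : φ.IsSwitchingSequence q s) {j : ℕ} (hj : j < q) :
    ∃ l, φ.endTime l = s (j + 1) := by
  have h : s (j + 1) ∈ insert 0 (range φ.endTime) := by
    rw [← hs.image]
    exact mem_image_of_mem s (Nat.succ_le_of_lt hj)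
  rcases h with h | h
  · exact absurd h ((hs.nonneg hj.le).trans_lt (hs.lt_succ hj)).ne'
  · exact h

theorem endTime_eq (hs : φ.IsSwitchingSequence q s) (l : φ.Idx) :
    ∃ j ≤ q, s j = φ.endTime l := by
  have h : φ.endTime l ∈ s '' Iic q := by
    rw [hs.image]
    exact mem_insert_of_mem _ (mem_range_self l)
  exact h

theorem endTime_le (hs : φ.IsSwitchingSequence q s) (l : φ.Idx) : φ.endTime l ≤ s q := by
  obtain ⟨j, hj, h⟩ := hs.endTime_eq l
  exact h ▸ hs.strictMono.monotoneOn hj (mem_Iic.2 le_rfl) hj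

/-- No window ends strictly between consecutive switching times, so the switching functions are
constant on `[s j, s (j + 1))`. -/
theorem lt_endTime_iff (hs : φ.IsSwitchingSequence q s) {j : ℕ} (hj : j < q) {t : ℝ}
    (ht : t ∈ Ico (s j) (s (j + 1))) (l : φ.Idx) :
    t < φ.endTime l ↔ s (j + 1) ≤ φ.endTime l := by
  refine ⟨fun h => ?_, fun h => ht.2.trans_le h⟩
  obtain ⟨i, hi, hil⟩ := hs.endTime_eq l
  rw [← hil] at h ⊢
  exact hs.strictMono.monotoneOn (Nat.succ_le_of_lt hj) hi
    ((hs.strictMono.lt_iff_lt hj.le hi).1 (ht.1.trans_lt h))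

end Formula.IsSwitchingSequence

/-- The argument of the logarithm in `barrier`, with arbitrary weights. -/
def expSum {n k : ℕ} {ι : Type} [Fintype ι] (η : ℝ) (ω : ι → ℝ) (β : ι → Vec n → ℝ → ℝ)
    (γ : Fin k → Vec n → ℝ → ℝ) (y : Vec n) (t : ℝ) : ℝ :=
  (∑ l, ω l * Real.exp (-η * β l y t)) + ∑ i, Real.exp (-η * γ i y t)

section expSum

variable {n k : ℕ} {ι : Type} [Fintype ι] {η : ℝ} {ω : ι → ℝ} {β : ι → Vec n → ℝ → ℝ}
  {γ : Fin k → Vec n → ℝ → ℝ}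

theorem expSum_mono {ω' : ι → ℝ} (h : ω ≤ ω') (y : Vec n) (t : ℝ) :
    expSum η ω β γ y t ≤ expSum η ω' β γ y t :=
  add_le_add_left (Finset.sum_le_sum fun l _ =>
    mul_le_mul_of_nonneg_right (h l) (Real.exp_pos _).le) _

theorem expSum_nonneg (h : 0 ≤ ω) (y : Vec n) (t : ℝ) : 0 ≤ expSum η ω β γ y t :=
  add_nonneg (Finset.sum_nonneg fun l _ => mul_nonneg (h l) (Real.exp_pos _).le)
    (Finset.sum_nonneg fun _ _ => (Real.exp_pos _).le)

theorem mul_exp_le_expSum (h : 0 ≤ ω) (l : ι) (y : Vec n) (t : ℝ) :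
    ω l * Real.exp (-η * β l y t) ≤ expSum η ω β γ y t :=
  (Finset.single_le_sum (f := fun l => ω l * Real.exp (-η * β l y t))
    (fun l _ => mul_nonneg (h l) (Real.exp_pos _).le) (Finset.mem_univ l)).trans
    (le_add_of_nonneg_right (Finset.sum_nonneg fun _ _ => (Real.exp_pos _).le))

theorem expSum_pos (h : 0 ≤ ω) {l : ι} (hl : 0 < ω l) (y : Vec n) (t : ℝ) :
    0 < expSum η ω β γ y t :=
  (mul_pos hl (Real.exp_pos _)).trans_le (mul_exp_le_expSum h l y t)

theorem continuousOn_expSum {A : Set (Vec n × ℝ)}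
    (hβ : ∀ l, ContinuousOn (fun p : Vec n × ℝ => β l p.1 p.2) A)
    (hγ : ∀ i, ContinuousOn (fun p : Vec n × ℝ => γ i p.1 p.2) A) :
    ContinuousOn (fun p : Vec n × ℝ => expSum η ω β γ p.1 p.2) A :=
  (continuousOn_finsetSum _ fun l _ =>
    (((hβ l).const_mul (-η)).rexp.const_mul (ω l))).add
    (continuousOn_finsetSum _ fun i _ => ((hγ i).const_mul (-η)).rexp)

theorem neg_log_nonneg_of_le_one (hη : 0 < η) {r : ℝ} (h0 : 0 ≤ r) (h1 : r ≤ 1) :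
    0 ≤ -(1 / η) * Real.log r :=
  mul_nonneg_of_nonpos_of_nonpos (by simpa using hη.le) (Real.log_nonpos h0 h1)

theorem le_one_of_neg_log_nonneg (hη : 0 < η) {r : ℝ} (h0 : 0 < r)
    (h : 0 ≤ -(1 / η) * Real.log r) : r ≤ 1 := by
  rw [neg_mul, Left.nonneg_neg_iff] at h
  exact (Real.log_nonpos_iff h0.le).1 (nonpos_of_mul_nonpos_right h (by positivity))

end expSum

section barrier

variable {n k : ℕ} {φ : Formula n} {η : ℝ} {β : φ.Idx → Vec n → ℝ → ℝ}
  {γ : Fin k → Vec n → ℝ → ℝ} {q : ℕ} {s : ℕ → ℝ}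

theorem barrier_eq (y : Vec n) (t : ℝ) : barrier φ η β γ y t =
    -(1 / η) * Real.log (expSum η (fun l => φ.active l t) β γ y t) := rfl

theorem Formula.active_nonneg (φ : Formula n) (t : ℝ) : 0 ≤ fun l => φ.active l t := fun l => by
  simp only [Formula.active]
  split_ifs <;> simp

open Classical in
/-- The values of the switching functions on `[s j, s (j + 1))`. -/
def Formula.weight (φ : Formula n) (r : ℝ) (l : φ.Idx) : ℝ := if r ≤ φ.endTime l then 1 else 0

theorem Formula.weight_nonneg (φ : Formula n) (r : ℝ) : 0 ≤ φ.weight r := fun l => by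
  simp only [Formula.weight]
  split_ifs <;> simp

/-- The two sides differ exactly at the literals with end time `r`: still counted by the weight,
already switched off at time `r`. -/
theorem Formula.active_le_weight (φ : Formula n) (r : ℝ) :
    (fun l => φ.active l r) ≤ φ.weight r := fun l => by
  simp only [Formula.weight, Formula.active]
  split_ifs with h1 h2
  · exact le_rfl
  · exact absurd h1.le h2
  · exact zero_le_one
  · exact le_rfl

theorem Formula.IsSwitchingSequence.active_eq (hs : φ.IsSwitchingSequence q s) {j : ℕ} (hj : j < q)
    {t : ℝ} (ht : t ∈ Ico (s j) (s (j + 1))) :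
    (fun l => φ.active l t) = φ.weight (s (j + 1)) := by
  funext l
  simp only [Formula.active, Formula.weight, hs.lt_endTime_iff hj ht]

/-- Some literal ends at `s (j + 1)` and is active until then, so the logarithm is taken of a
positive number even when `k = 0`. -/
theorem Formula.IsSwitchingSequence.expSum_weight_pos (hs : φ.IsSwitchingSequence q s) {j : ℕ}
    (hj : j < q) (y : Vec n) (t : ℝ) : 0 < expSum η (φ.weight (s (j + 1))) β γ y t := by
  obtain ⟨l, hl⟩ := hs.exists_endTime_eq hj
  exact expSum_pos (φ.weight_nonneg _) (l := l) (by simp [Formula.weight, hl]) y t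

theorem Formula.IsSwitchingSequence.continuousOn_barrier (hs : φ.IsSwitchingSequence q s) {j : ℕ}
    (hj : j < q)
    (hβ : ∀ l, ContinuousOn (fun p : Vec n × ℝ => β l p.1 p.2) (univ ×ˢ Ici 0))
    (hγ : ∀ i, ContinuousOn (fun p : Vec n × ℝ => γ i p.1 p.2) (univ ×ˢ Ici 0)) :
    ContinuousOn (fun p : Vec n × ℝ => barrier φ η β γ p.1 p.2)
      (univ ×ˢ Ico (s j) (s (j + 1))) := by
  have h : ContinuousOn (fun p : Vec n × ℝ => -(1 / η) * Real.log
      (expSum η (φ.weight (s (j + 1))) β γ p.1 p.2)) (univ ×ˢ Ico (s j) (s (j + 1))) :=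
    (((continuousOn_expSum hβ hγ).mono (prod_mono_right fun t ht =>
      (hs.nonneg hj.le).trans ht.1)).log fun p _ => (hs.expSum_weight_pos hj _ _).ne').const_mul _
  refine h.congr fun p hp => ?_
  rw [barrier_eq, hs.active_eq hj hp.2]

/-- Switching off literals at `s (j + 1)` does not destroy nonnegativity of the barrier. -/
theorem Formula.IsSwitchingSequence.barrier_nonneg_succ (hs : φ.IsSwitchingSequence q s)
    (hη : 0 < η) {j : ℕ} (hj : j < q)
    (hβ : ∀ l, ContinuousOn (fun p : Vec n × ℝ => β l p.1 p.2) (univ ×ˢ Ici 0))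
    (hγ : ∀ i, ContinuousOn (fun p : Vec n × ℝ => γ i p.1 p.2) (univ ×ˢ Ici 0))
    {x : ℝ → Vec n} (hx : ContinuousOn x (Icc (s j) (s (j + 1))))
    (h : ∀ t ∈ Ico (s j) (s (j + 1)), 0 ≤ barrier φ η β γ (x t) t) :
    0 ≤ barrier φ η β γ (x (s (j + 1))) (s (j + 1)) := by
  have hlt := hs.lt_succ hj
  -- With the weights frozen at their values before the switch, the sum is continuous up to `s (j +
  -- 1)`, and the bound by `1` passes to the limit.
  have hc : ContinuousOn (fun t => expSum η (φ.weight (s (j + 1))) β γ (x t) t)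
      (Icc (s j) (s (j + 1))) :=
    (continuousOn_expSum hβ hγ).comp (f := fun t => (x t, t)) (hx.prodMk continuousOn_id)
      fun t ht => ⟨mem_univ _, (hs.nonneg hj.le).trans ht.1⟩
  have hle : expSum η (φ.weight (s (j + 1))) β γ (x (s (j + 1))) (s (j + 1)) ≤ 1 := by
    have hcl : s (j + 1) ∈ closure (Ico (s j) (s (j + 1))) := by
      rw [closure_Ico hlt.ne]
      exact right_mem_Icc.2 hlt.le
    refine ContinuousWithinAt.closure_le hcl
      ((hc _ (right_mem_Icc.2 hlt.le)).mono Ico_subset_Icc_self) continuousWithinAt_const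
      fun t ht => le_one_of_neg_log_nonneg hη (hs.expSum_weight_pos hj _ _) ?_
    rw [← hs.active_eq hj ht]
    exact h t ht
  -- At `s q` with `k = 0` the sum is `0`; then `Real.log 0 = 0` gives the barrier the value `0`, so
  -- positivity is not required here.
  exact neg_log_nonneg_of_le_one hη (expSum_nonneg (φ.active_nonneg _) _ _)
    ((expSum_mono (φ.active_le_weight _) _ _).trans hle)

/-- The barrier is a smooth minimum: it is nonnegative only if the sum is at most `1`, which bounds
each active summand. -/
theorem nonneg_of_barrier_nonneg (hη : 0 < η) {l : φ.Idx} {y : Vec n} {t : ℝ}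
    (ht : t < φ.endTime l) (h : 0 ≤ barrier φ η β γ y t) : 0 ≤ β l y t := by
  have hl : φ.active l t = 1 := if_pos ht
  have h1 := le_one_of_neg_log_nonneg hη
    (expSum_pos (φ.active_nonneg t) (l := l) (by simp [hl]) y t) h
  have h2 := (mul_exp_le_expSum (φ.active_nonneg t) l y t).trans h1
  rw [hl, one_mul, Real.exp_le_one_iff, neg_mul, Left.neg_nonpos_iff] at h2
  exact nonneg_of_mul_nonneg_right h2 hη

theorem Formula.IsSwitchingSequence.sat_of_barrier_nonneg (hs : φ.IsSwitchingSequence q s)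
    (hη : 0 < η) (hβ : ∀ l, ContinuousOn (fun p : Vec n × ℝ => β l p.1 p.2) (univ ×ˢ Ici 0))
    {σ : UntilStart} (hsteps : φ.Steps σ β) {x : ℝ → Vec n} (hx : ContinuousOn x (Icc 0 (s q)))
    (h : ∀ t ∈ Ico 0 (s q), 0 ≤ barrier φ η β γ (x t) t) : φ.Sat σ x := by
  refine φ.sat_of_steps σ β hsteps x fun l => ?_
  have hpos := φ.endTime_pos l
  have hle := hs.endTime_le l
  have hc : ContinuousOn (fun t => β l (x t) t) (Icc 0 (φ.endTime l)) :=
    (hβ l).comp (f := fun t => (x t, t))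
      ((hx.mono (Icc_subset_Icc_right hle)).prodMk continuousOn_id)
      fun t ht => ⟨mem_univ _, ht.1⟩
  intro t ht
  have hcl : t ∈ closure (Ico 0 (φ.endTime l)) := by rwa [closure_Ico hpos.ne]
  exact ContinuousWithinAt.closure_le (f := fun _ => 0) (g := fun τ => β l (x τ) τ) hcl
    continuousWithinAt_const ((hc t ht).mono Ico_subset_Icc_self) fun τ hτ =>
      nonneg_of_barrier_nonneg hη hτ.2 (h τ ⟨hτ.1, hτ.2.trans_le hle⟩)

end barrier

open Pointwise in
-- Near `x`, the values of `v + c` lie in the hull of the values of `v` plus a small ball around `c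
-- x t`. This sum of convex sets is convex, so it contains the whole hull.
theorem sub_mem_filippovMap {n : ℕ} {v c : Vec n → ℝ → Vec n} {x ζ : Vec n} {t : ℝ}
    (hc : ContinuousAt (fun y => c y t) x)
    (hζ : ζ ∈ filippovMap (fun y τ => v y τ + c y τ) x t) :
    ζ - c x t ∈ filippovMap v x t := by
  simp only [filippovMap, mem_iInter] at hζ ⊢
  intro δ hδ N hN
  refine Metric.mem_closure_iff.2 fun ε hε => ?_
  obtain ⟨r, hr, hrc⟩ := Metric.continuousAt_iff.1 hc (ε / 2) (half_pos hε)
  have hz := hζ (min δ r) (lt_min hδ hr) N hN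
  obtain ⟨z, hz, hdist⟩ := Metric.mem_closure_iff.1 hz (ε / 2) (half_pos hε)
  have hsub : convexHull ℝ ((fun y => v y t + c y t) '' (Metric.ball x (min δ r) \ N)) ⊆
      convexHull ℝ ((fun y => v y t) '' (Metric.ball x δ \ N)) +
        Metric.closedBall (c x t) (ε / 2) := by
    refine convexHull_min ?_ ((convex_convexHull ℝ _).add (convex_closedBall _ _))
    rintro _ ⟨y, ⟨hy, hyN⟩, rfl⟩
    refine add_mem_add (subset_convexHull ℝ _ (mem_image_of_mem _
      ⟨Metric.ball_subset_ball (min_le_left _ _) hy, hyN⟩)) ?_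
    exact (hrc (Metric.ball_subset_ball (min_le_right _ _) hy)).le
  obtain ⟨w, hw, e, he, rfl⟩ := hsub hz
  refine ⟨w, hw, ?_⟩
  calc dist (ζ - c x t) w = dist ζ (w + c x t) := by
        rw [dist_eq_norm, dist_eq_norm]; congr 1; abel
    _ ≤ dist ζ (w + e) + dist (w + e) (w + c x t) := dist_triangle _ _ _
    _ < ε / 2 + ε / 2 := by
        rw [dist_add_left]; exact add_lt_add_of_lt_of_le hdist he
    _ = ε := add_halves ε

/-- A perturbation bounded by `C` does not destroy the decrease condition. -/
theorem nonneg_of_lieDerivative {n : ℕ} {v c : Vec n → ℝ → Vec n} {b : Vec n → ℝ → ℝ}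
    {y ζ : Vec n} {t C a : ℝ} (hc : ContinuousAt (fun z => c z t) y) (hC : ‖c y t‖ ≤ C)
    (hζ : ζ ∈ filippovMap (fun z τ => v z τ + c z τ) y t) (ha : a ≤ 0)
    (h : ∀ r ∈ lieDerivative v b y t, -a + ‖fderiv ℝ (fun z => b z t) y‖ * C ≤ r) :
    0 ≤ fderiv ℝ (fun z => b z t) y ζ + deriv (fun τ => b y τ) t := by
  have h1 := h _ ⟨_, sub_mem_filippovMap hc hζ, rfl⟩
  rw [map_sub] at h1
  have h2 : -(fderiv ℝ (fun z => b z t) y (c y t)) ≤ ‖fderiv ℝ (fun z => b z t) y‖ * C :=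
    (neg_le_abs _).trans (((fderiv ℝ (fun z => b z t) y).le_opNorm _).trans
      (mul_le_mul_of_nonneg_left hC (norm_nonneg _)))
  linarith

/-- Forward invariance of the superlevel sets of the barrier. The differential inclusion is
only needed at the times at which the curve lies in an open set containing the superlevel sets. -/
theorem Formula.IsSwitchingSequence.barrier_nonneg {n k : ℕ} {φ : Formula n} {η : ℝ}
    {β : φ.Idx → Vec n → ℝ → ℝ} {γ : Fin k → Vec n → ℝ → ℝ} {q : ℕ} {s : ℕ → ℝ}
    (hs : φ.IsSwitchingSequence q s) (hη : 0 < η)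
    (hβ : ∀ l, ContinuousOn (fun p : Vec n × ℝ => β l p.1 p.2) (univ ×ˢ Ici 0))
    (hγ : ∀ i, ContinuousOn (fun p : Vec n × ℝ => γ i p.1 p.2) (univ ×ˢ Ici 0))
    (hsmooth : ∀ j < q, ContDiffOn ℝ 1 (fun p : Vec n × ℝ => barrier φ η β γ p.1 p.2)
      (univ ×ˢ Ioo (s j) (s (j + 1))))
    {D : ℕ → Set (Vec n)} (hD : ∀ j < q, IsOpen (D j))
    (hsafe : ∀ j < q, ∀ t ∈ Ico (s j) (s (j + 1)), safeSet (barrier φ η β γ) t ⊆ D j)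
    {x : ℝ → Vec n} {T : ℝ} (hT : 0 ≤ T) (hx : AbsolutelyContinuousOnInterval x 0 T)
    (hderiv : ∀ j < q, ∀ᵐ t, t ∈ Icc 0 T → t ∈ Ioo (s j) (s (j + 1)) → x t ∈ D j →
      barrier φ η β γ (x t) t < 0 → ∃ ζ, HasDerivAt x ζ t ∧
        0 ≤ fderiv ℝ (fun y => barrier φ η β γ y t) (x t) ζ +
          deriv (fun τ => barrier φ η β γ (x t) τ) t)
    (h0 : 0 ≤ barrier φ η β γ (x 0) 0) :
    ∀ t ∈ Icc 0 T, t < s q → 0 ≤ barrier φ η β γ (x t) t := by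
  have hxc : ContinuousOn x (Icc 0 T) := by simpa [uIcc_of_le hT] using hx.continuousOn
  -- The value at `s j` is carried separately: `b` may jump there, and the next interval starts from
  -- it, provided that the curve reaches it.
  have key : ∀ j ≤ q, (∀ t ∈ Icc 0 T, t < s j → 0 ≤ barrier φ η β γ (x t) t) ∧
      (s j ≤ T → 0 ≤ barrier φ η β γ (x (s j)) (s j)) := by
    intro j
    induction j with
    | zero =>
      refine fun _ => ⟨fun t ht h => ?_, fun _ => ?_⟩
      · rw [hs.zero] at h
        exact absurd ht.1 h.not_ge
      · rwa [hs.zero]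
    | succ j ih =>
      intro hj
      replace hj : j < q := hj
      obtain ⟨ih₁, ih₂⟩ := ih hj.le
      have hsj := hs.nonneg hj.le
      have h1 : ∀ t ∈ Icc 0 T, t < s (j + 1) → 0 ≤ barrier φ η β γ (x t) t := by
        intro t ht hts
        rcases lt_or_ge t (s j) with h | h
        · exact ih₁ t ht h
        · have hxt : AbsolutelyContinuousOnInterval x (s j) t := hx.mono (by
            rw [uIcc_of_le h, uIcc_of_le hT]
            exact Icc_subset_Icc hsj ht.2)
          refine hxt.nonneg_of_barrier (hD j hj) (hs.continuousOn_barrier hj hβ hγ)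
            (hsmooth j hj) (fun τ hτ y hy => hsafe j hj τ hτ hy) hts ?_ h (ih₂ (h.trans ht.2))
          filter_upwards [hderiv j hj] with τ hτ hτt hτD hneg
          exact hτ ⟨hsj.trans hτt.1.le, hτt.2.le.trans ht.2⟩ ⟨hτt.1, hτt.2.trans hts⟩ hτD hneg
      refine ⟨h1, fun hjT => hs.barrier_nonneg_succ hη hj hβ hγ
        (hxc.mono (Icc_subset_Icc hsj hjT)) fun t ht =>
        h1 t ⟨hsj.trans ht.1, ht.2.le.trans hjT⟩ ht.2⟩
  exact (key q le_rfl).1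

end STLBarrier
end

/-! ### Existence of Filippov solutions for bounded right-hand sides. -/

noncomputable section

/-- A sequence of curves with a common Lipschitz constant and a common initial value has a
pointwise convergent subsequence. -/
theorem exists_subseq_tendsto_of_lipschitzWith {E : Type*} [MetricSpace E] [ProperSpace E]
    {K : NNReal} {x : ℕ → ℝ → E} (hx : ∀ k, LipschitzWith K (x k)) {t₀ : ℝ} {x₀ : E}
    (h0 : ∀ k, x k t₀ = x₀) :
    ∃ (θ : ℕ → ℕ) (z : ℝ → E), StrictMono θ ∧ (∀ t, Tendsto (fun k => x (θ k) t) atTop (𝓝 (z t))) ∧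
      LipschitzWith K z := by
  -- Compactness of a countable product replaces the diagonal argument on `ℚ`; the common Lipschitz
  -- constant carries convergence over to all times.
  have hcpt : IsCompact (Set.pi univ fun r : ℚ => Metric.closedBall x₀ (K * dist (r : ℝ) t₀)) :=
    isCompact_univ_pi fun r => isCompact_closedBall _ _
  obtain ⟨a, -, θ, hθ, ha⟩ := hcpt.tendsto_subseq (x := fun k (r : ℚ) => x k r) fun k r _ => by
    rw [Metric.mem_closedBall, ← h0 k]
    exact (hx k).dist_le_mul _ _
  have hcauchy : ∀ t, CauchySeq fun k => x (θ k) t := by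
    intro t
    refine Metric.cauchySeq_iff.2 fun ε hε => ?_
    have hK : (0 : ℝ) < K + 1 := by positivity
    obtain ⟨r, hr⟩ := exists_rat_near t (show 0 < ε / 3 / (K + 1) by positivity)
    have hclose : ∀ k, dist (x k t) (x k r) < ε / 3 := fun k => by
      refine ((hx k).dist_le_mul t r).trans_lt ?_
      rw [lt_div_iff₀ hK] at hr
      rw [Real.dist_eq]
      nlinarith [abs_nonneg (t - r)]
    obtain ⟨N, hN⟩ := Metric.cauchySeq_iff.1 ((tendsto_pi_nhds.1 ha r).cauchySeq) (ε / 3)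
      (by positivity)
    refine ⟨N, fun i hi j hj => ?_⟩
    have h1 := hclose (θ i)
    have h2 := hclose (θ j)
    have h3 : dist (x (θ i) r) (x (θ j) r) < ε / 3 := hN i hi j hj
    rw [dist_comm] at h2
    linarith [dist_triangle4 (x (θ i) t) (x (θ i) r) (x (θ j) r) (x (θ j) t)]
  choose z hz using fun t => cauchySeq_tendsto_of_complete (hcauchy t)
  refine ⟨θ, z, hθ, hz, LipschitzWith.of_dist_le_mul fun t t' => ?_⟩
  exact le_of_tendsto ((hz t).dist (hz t')) (Eventually.of_forall fun k => (hx _).dist_le_mul t t')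

section WeakLimit

variable {E : Type*} [NormedAddCommGroup E] [InnerProductSpace ℝ E] [FiniteDimensional ℝ E]

theorem intervalIntegrable_of_norm_le {F : Type*} [NormedAddCommGroup F] {y : ℝ → F} {M : ℝ}
    (hM : ∀ t, ‖y t‖ ≤ M) (hy : AEStronglyMeasurable y volume) (a b : ℝ) :
    IntervalIntegrable y volume a b :=
  (intervalIntegrable_const (c := M)).mono_fun hy.restrict
    (Eventually.of_forall fun t => (hM t).trans (le_abs_self M))

/-- If curves with bounded derivatives `y k` converge pointwise, then the derivative of the limit
lies in each closed convex set that eventually contains the `y k`. -/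
theorem ae_deriv_mem_of_tendsto {M : NNReal} {y x : ℕ → ℝ → E} {z : ℝ → E}
    (hM : ∀ k t, ‖y k t‖ ≤ M) (hy : ∀ k, AEStronglyMeasurable (y k) volume)
    (hx : ∀ k s t, x k t - x k s = ∫ τ in s..t, y k τ)
    (hz : ∀ t, Tendsto (fun k => x k t) atTop (𝓝 (z t))) (hzM : LipschitzWith M z) :
    ∀ᵐ t, DifferentiableAt ℝ z t ∧ ∀ S : Set E, IsClosed S → Convex ℝ S →
      (∀ᶠ k in atTop, y k t ∈ S) → deriv z t ∈ S := by
  have hle : ∀ p k t, inner ℝ p (y k t) ≤ ‖p‖ * M := fun p k t =>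
    (real_inner_le_norm _ _).trans (mul_le_mul_of_nonneg_left (hM k t) (norm_nonneg p))
  have hge : ∀ p k t, -(‖p‖ * M) ≤ inner ℝ p (y k t) := fun p k t => by
    have := hle (-p) k t
    rw [inner_neg_left, norm_neg] at this
    linarith
  -- An upper bound for `⟪p, y k⟫` over the tail `k ≥ m`. Integrating it and passing to the limit
  -- bounds the increments of `⟪p, z⟫`, whence `⟪p, deriv z⟫ ≤ Y p m` almost everywhere.
  set Y : E → ℕ → ℝ → ℝ := fun p m t => ⨆ k, inner ℝ p (y (m + k) t) with hY
  have hbdd : ∀ p m t, BddAbove (range fun k => inner ℝ p (y (m + k) t)) := fun p m t =>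
    ⟨‖p‖ * M, by rintro _ ⟨k, rfl⟩; exact hle p _ t⟩
  have hYnorm : ∀ p m t, ‖Y p m t‖ ≤ ‖p‖ * M := fun p m t => by
    rw [Real.norm_eq_abs, abs_le]
    exact ⟨(hge p (m + 0) t).trans (le_ciSup (hbdd p m t) 0), ciSup_le fun k => hle p _ t⟩
  have hYmeas : ∀ p m, AEStronglyMeasurable (Y p m) volume := fun p m =>
    (AEMeasurable.iSup fun k =>
      (aestronglyMeasurable_const.inner (hy (m + k))).aemeasurable).aestronglyMeasurable
  have hYint : ∀ p m a b, IntervalIntegrable (Y p m) volume a b := fun p m =>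
    intervalIntegrable_of_norm_le (hYnorm p m) (hYmeas p m)
  have hmono : ∀ p m, Monotone fun t => (∫ τ in (0 : ℝ)..t, Y p m τ) - inner ℝ p (z t) := by
    intro p m s t hst
    have h1 : inner ℝ p (z t - z s) ≤ ∫ τ in s..t, Y p m τ := by
      have hlim : Tendsto (fun k => inner ℝ p (x k t - x k s)) atTop (𝓝 (inner ℝ p (z t - z s))) :=
        tendsto_const_nhds.inner ((hz t).sub (hz s))
      refine le_of_tendsto hlim ?_
      filter_upwards [eventually_ge_atTop m] with k hk
      have hyk := intervalIntegrable_of_norm_le (hM k) (hy k) s t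
      have hcomm := (innerSL ℝ p).intervalIntegral_comp_comm hyk
      simp only [innerSL_apply_apply] at hcomm
      rw [hx, ← hcomm]
      refine intervalIntegral.integral_mono_on hst
        (intervalIntegrable_of_norm_le (M := ‖p‖ * M) (fun τ => ?_)
          (aestronglyMeasurable_const.inner (hy k)) s t) (hYint p m s t) fun τ _ => ?_
      · rw [Real.norm_eq_abs, abs_le]
        exact ⟨hge p k τ, hle p k τ⟩
      · obtain ⟨i, rfl⟩ := Nat.exists_eq_add_of_le hk
        exact le_ciSup (hbdd p m τ) i
    have h2 := intervalIntegral.integral_add_adjacent_intervals (hYint p m 0 s) (hYint p m s t)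
    rw [inner_sub_right] at h1
    simp only
    linarith
  -- Only countably many `p` and `m` occur, so one null set serves for all closed convex `S`, chosen
  -- after `t`.
  have hae : ∀ᵐ t, ∀ i m, HasDerivAt (fun τ => ∫ u in (0 : ℝ)..τ,
      Y (TopologicalSpace.denseSeq E i) m u) (Y (TopologicalSpace.denseSeq E i) m t) t := by
    refine ae_all_iff.2 fun i => ae_all_iff.2 fun m => ?_
    set p := TopologicalSpace.denseSeq E i
    have hloc : LocallyIntegrable (Y p m) volume :=
      (locallyIntegrable_const (‖p‖ * M)).mono (hYmeas p m)
        (Eventually.of_forall fun t => (hYnorm p m t).trans (le_abs_self _))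
    filter_upwards [_root_.LocallyIntegrable.ae_hasDerivAt_integral hloc] with t ht using ht 0
  filter_upwards [hae, hzM.ae_differentiableAt_real] with t ht hdiff
  refine ⟨hdiff, fun S hS hSc hev => ?_⟩
  obtain ⟨m, hm⟩ := eventually_atTop.1 hev
  by_contra hnot
  set d := deriv z t
  obtain ⟨f, u, hfu, huf⟩ := geometric_hahn_banach_closed_point hSc hS hnot
  set p₀ := (InnerProductSpace.toDual ℝ E).symm f
  have hp₀ : ∀ w, f w = inner ℝ p₀ w := fun w =>
    (InnerProductSpace.toDual_symm_apply).symm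
  -- Replacing the separating vector `p₀` by a nearby dense one costs at most `ε (M + ‖d‖)`, less
  -- than the gap `f d - u`.
  set ε := (f d - u) / (M + ‖d‖ + 1)
  have hden : 0 < M + ‖d‖ + 1 := by positivity
  have hε : 0 < ε := div_pos (sub_pos.2 huf) hden
  obtain ⟨i, hi⟩ := (TopologicalSpace.denseRange_denseSeq E).exists_dist_lt p₀ hε
  replace ht := ht i m
  set p := TopologicalSpace.denseSeq E i
  have hpert : ∀ w, |inner ℝ p w - f w| ≤ ε * ‖w‖ := fun w => by
    rw [hp₀, ← inner_sub_left]
    refine (abs_real_inner_le_norm _ _).trans (mul_le_mul_of_nonneg_right ?_ (norm_nonneg w))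
    rw [← dist_eq_norm, dist_comm]
    exact hi.le
  have h1 : inner ℝ p d ≤ Y p m t := by
    have hinner : HasDerivAt (fun τ => inner ℝ p (z τ)) (inner ℝ p d) t := by
      simpa using (hasDerivAt_const t p).inner ℝ hdiff.hasDerivAt
    exact sub_nonneg.1 ((ht.sub hinner).nonneg_of_monotone (hmono p m))
  have h2 : Y p m t ≤ u + ε * M := ciSup_le fun k => by
    have h3 := (abs_le.1 (hpert (y (m + k) t))).2
    have h4 := hfu _ (hm (m + k) (Nat.le_add_right m k))
    have h5 := mul_le_mul_of_nonneg_left (hM (m + k) t) hε.le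
    linarith
  have h3 := (abs_le.1 (hpert d)).1
  have h4 : ε * (M + ‖d‖ + 1) = f d - u := div_mul_cancel₀ _ hden.ne'
  linarith

end WeakLimit

section EulerScheme

variable {E : Type*} [NormedAddCommGroup E] [NormedSpace ℝ E] [FiniteDimensional ℝ E]
  [MeasurableSpace E] [BorelSpace E]

/-- A curve whose derivative `y` is obtained from `V` by freezing the first argument on
intervals of length `h`. -/
theorem exists_euler_curve {V : E → ℝ → E} {M : NNReal} (hM : ∀ w t, ‖V w t‖ ≤ M)
    (hV : ∀ w, AEStronglyMeasurable (V w) volume) (t₀ : ℝ) (x₀ : E) {h : ℝ} (hh : 0 < h) :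
    ∃ y : ℝ → E, AEStronglyMeasurable y volume ∧ (∀ t, ‖y t‖ ≤ M) ∧
      ∀ t, t₀ ≤ t → ∃ w, y t = V w t ∧ ‖w - (x₀ + ∫ τ in t₀..t, y τ)‖ ≤ M * h := by
  set X : ℕ → E := fun i => Nat.rec x₀
    (fun i w => w + ∫ τ in (t₀ + i * h)..(t₀ + (i + 1 : ℕ) * h), V w τ) i with hX
  have hXsucc : ∀ i, X (i + 1) = X i + ∫ τ in (t₀ + i * h)..(t₀ + (i + 1 : ℕ) * h), V (X i) τ :=
    fun i => rfl
  -- For `t < t₀` the natural floor is `0` and `y` is `V x₀`; only its bound and measurability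
  -- matter there.
  set y : ℝ → E := fun t => V (X ⌊(t - t₀) / h⌋₊) t with hy
  have hymeas : AEStronglyMeasurable y volume := by
    have h1 : Measurable fun p : ℕ × ℝ => (hV (X p.1)).mk (V (X p.1)) p.2 :=
      measurable_from_prod_countable_right fun i => (hV (X i)).stronglyMeasurable_mk.measurable
    have h2 : Measurable fun t : ℝ => (⌊(t - t₀) / h⌋₊, t) :=
      (Nat.measurable_floor.comp ((measurable_id.sub_const t₀).div_const h)).prodMk measurable_id
    refine ⟨_, (h1.comp h2).stronglyMeasurable, ?_⟩
    filter_upwards [ae_all_iff.2 fun i => (hV (X i)).ae_eq_mk] with t ht using ht _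
  have hynorm : ∀ t, ‖y t‖ ≤ M := fun t => hM _ t
  have hyint := intervalIntegrable_of_norm_le hynorm hymeas
  have hXeq : ∀ i : ℕ, X i = x₀ + ∫ τ in t₀..(t₀ + i * h), y τ := by
    intro i
    induction i with
    | zero => simp [hX]
    | succ i ih =>
      have hle : t₀ + i * h ≤ t₀ + (i + 1 : ℕ) * h := by
        push_cast
        linarith
      have hcongr : ∫ τ in (t₀ + i * h)..(t₀ + (i + 1 : ℕ) * h), V (X i) τ =
          ∫ τ in (t₀ + i * h)..(t₀ + (i + 1 : ℕ) * h), y τ := by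
        refine intervalIntegral.integral_congr_Ioo_of_le hle fun t ht => ?_
        have hfl : ⌊(t - t₀) / h⌋₊ = i := by
          have h1 := ht.1
          have h2 := ht.2
          push_cast at h2
          rw [Nat.floor_eq_iff (div_nonneg (by nlinarith [i.cast_nonneg (α := ℝ)]) hh.le),
            le_div_iff₀ hh, div_lt_iff₀ hh]
          constructor <;> linarith
        simp only [hy, hfl]
      rw [hXsucc, hcongr, ih, add_assoc,
        intervalIntegral.integral_add_adjacent_intervals (hyint _ _) (hyint _ _)]
  refine ⟨y, hymeas, hynorm, fun t ht => ⟨X ⌊(t - t₀) / h⌋₊, rfl, ?_⟩⟩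
  set i := ⌊(t - t₀) / h⌋₊
  have hi1 : (i : ℝ) * h ≤ t - t₀ := by
    rw [← le_div_iff₀ hh]
    exact Nat.floor_le (div_nonneg (sub_nonneg.2 ht) hh.le)
  have hi2 : t - t₀ < (i + 1) * h := by
    rw [← div_lt_iff₀ hh]
    exact Nat.lt_floor_add_one _
  have hsub := intervalIntegral.integral_interval_sub_left (hyint t₀ (t₀ + i * h)) (hyint t₀ t)
  rw [hXeq, add_sub_add_left_eq_sub, hsub]
  refine (intervalIntegral.norm_integral_le_of_norm_le_const fun τ _ => hynorm τ).trans
    (mul_le_mul_of_nonneg_left ?_ M.coe_nonneg)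
  rw [abs_le]
  constructor <;> linarith

end EulerScheme

theorem norm_setAverage_le {E F : Type*} [MeasureSpace E] [NormedAddCommGroup F] [NormedSpace ℝ F]
    {v : E → F} {M : NNReal} (hM : ∀ y, ‖v y‖ ≤ M) (s : Set E)
    (hs : volume s ≠ ⊤) : ‖⨍ y in s, v y‖ ≤ M := by
  rw [setAverage_eq, norm_smul, norm_inv, Real.norm_of_nonneg measureReal_nonneg]
  have h := norm_setIntegral_le_of_norm_le_const (μ := volume) (s := s) hs.lt_top fun y _ => hM y
  rcases measureReal_nonneg (μ := volume) (s := s) |>.eq_or_lt with h0 | h0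
  · rw [← h0]
    simp
  · rw [inv_mul_le_iff₀ h0, mul_comm]
    exact h

/-- An average ignores null sets. This is why the Euler scheme averages `v` over balls: point values
of `v` need not lie in the hull of its values off `N`. -/
theorem setAverage_mem_closure_convexHull {E F : Type*} [NormedAddCommGroup E] [NormedSpace ℝ E]
    [FiniteDimensional ℝ E] [MeasureSpace E] [BorelSpace E]
    [(volume : Measure E).IsAddHaarMeasure] [NormedAddCommGroup F] [NormedSpace ℝ F]
    [CompleteSpace F] {v : E → F} {M : NNReal}
    (hM : ∀ y, ‖v y‖ ≤ M)
    (hv : AEStronglyMeasurable v volume) (w : E) {r : ℝ} (hr : 0 < r) {A : Set E}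
    (hA : ∀ᵐ y, y ∈ Metric.ball w r → y ∈ A) :
    ⨍ y in Metric.ball w r, v y ∈ closure (convexHull ℝ (v '' A)) := by
  refine (convex_convexHull ℝ _).set_average_mem_closure (Metric.measure_ball_pos _ w hr).ne'
    measure_ball_lt_top.ne ?_ ?_
  · rw [ae_restrict_iff' measurableSet_ball]
    filter_upwards [hA] with y hy hyr using subset_convexHull ℝ _ (mem_image_of_mem v (hy hyr))
  · exact Measure.integrableOn_of_bounded measure_ball_lt_top.ne hv
      (Eventually.of_forall hM)

theorem aestronglyMeasurable_setAverage {E F : Type*} [MeasureSpace E]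
    [SFinite (volume : Measure E)] [NormedAddCommGroup F] [NormedSpace ℝ F] {v : E → ℝ → F}
    (hv : AEStronglyMeasurable (fun p : E × ℝ => v p.1 p.2) volume) (s : Set E) :
    AEStronglyMeasurable (fun t => ⨍ y in s, v y t) volume := by
  have h1 : AEStronglyMeasurable (fun p : E × ℝ => v p.1 p.2)
      ((volume.restrict s).prod volume) :=
    hv.mono_ac ((Measure.absolutelyContinuous_of_le Measure.restrict_le_self).prod
      Measure.AbsolutelyContinuous.rfl)
  simp only [setAverage_eq]
  exact (h1.prod_swap.integral_prod_right').const_smul _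

namespace STLBarrier

/-- Existence of Filippov solutions for bounded measurable right-hand sides. -/
theorem exists_filippov_solution {n : ℕ} {v : Vec n → ℝ → Vec n} {M : NNReal}
    (hM : ∀ y t, ‖v y t‖ ≤ M)
    (hv : AEStronglyMeasurable (fun p : Vec n × ℝ => v p.1 p.2) volume) (t₀ : ℝ) (x₀ : Vec n) :
    ∃ x : ℝ → Vec n, x t₀ = x₀ ∧ LipschitzWith M x ∧
      ∀ᵐ t, t₀ ≤ t → ∃ ζ ∈ filippovMap v (x t) t, HasDerivAt x ζ t := by
  set h : ℕ → ℝ := fun k => 1 / ((k : ℝ) + 1) with hh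
  have hpos : ∀ k, 0 < h k := fun k => Nat.one_div_pos_of_nat
  have hlim : Tendsto h atTop (𝓝 0) := tendsto_one_div_add_atTop_nhds_zero_nat
  choose y hymeas hynorm hyV using fun k => exists_euler_curve (M := M)
    (V := fun w t => ⨍ z in Metric.ball w (h k), v z t)
    (fun w t => norm_setAverage_le (fun z => hM z t) _ measure_ball_lt_top.ne)
    (fun w => aestronglyMeasurable_setAverage hv _) t₀ x₀ (hpos k)
  have hyint := fun k => intervalIntegrable_of_norm_le (hynorm k) (hymeas k)
  set x : ℕ → ℝ → Vec n := fun k t => x₀ + ∫ τ in t₀..t, y k τ with hx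
  have hsub : ∀ k s t, x k t - x k s = ∫ τ in s..t, y k τ := fun k s t => by
    simp only [hx]
    rw [add_sub_add_left_eq_sub,
      intervalIntegral.integral_interval_sub_left (hyint _ _ _) (hyint _ _ _)]
  have hLip : ∀ k, LipschitzWith M (x k) := fun k => LipschitzWith.of_dist_le_mul fun s t => by
    rw [dist_eq_norm, hsub, Real.dist_eq]
    exact intervalIntegral.norm_integral_le_of_norm_le_const fun τ _ => hynorm k τ
  obtain ⟨θ, z, hθ, hz, hzM⟩ := exists_subseq_tendsto_of_lipschitzWith hLip (t₀ := t₀) (x₀ := x₀)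
    fun k => by simp [hx]
  have hz0 : z t₀ = x₀ := tendsto_nhds_unique (hz t₀) (by simp [hx])
  refine ⟨z, hz0, hzM, ?_⟩
  have hvt : ∀ᵐ t, AEStronglyMeasurable (fun y => v y t) volume := by
    have h1 := hv
    rw [Measure.volume_eq_prod] at h1
    exact h1.prod_swap.prodMk_left
  filter_upwards [hvt, ae_deriv_mem_of_tendsto (fun k => hynorm (θ k)) (fun k => hymeas (θ k))
    (fun k => hsub (θ k)) hz hzM] with t hvt ⟨hdiff, hmem⟩ ht
  refine ⟨deriv z t, ?_, hdiff.hasDerivAt⟩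
  simp only [filippovMap, mem_iInter]
  intro δ hδ N hN
  refine hmem _ isClosed_closure (convex_convexHull ℝ _).closure ?_
  -- Distance from a point of the averaging ball to `z t`: radius of the ball, lag of the frozen
  -- Euler node, error of the convergence.
  have hlim' : Tendsto (fun k => h (θ k) + (M * h (θ k) + dist (x (θ k) t) (z t))) atTop (𝓝 0) := by
    have h1 := hlim.comp hθ.tendsto_atTop
    have h2 := h1.add ((h1.const_mul (M : ℝ)).add (tendsto_iff_dist_tendsto_zero.1 (hz t)))
    simpa using h2
  filter_upwards [hlim'.eventually_lt_const hδ] with k hk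
  obtain ⟨w, hw, hwx⟩ := hyV (θ k) t ht
  rw [hw]
  refine setAverage_mem_closure_convexHull (fun z => hM z t) hvt w (hpos _) ?_
  filter_upwards [measure_eq_zero_iff_ae_notMem.1 hN] with a haN ha
  refine ⟨?_, haN⟩
  rw [Metric.mem_ball] at ha ⊢
  rw [← dist_eq_norm] at hwx
  change dist w (x (θ k) t) ≤ M * h (θ k) at hwx
  linarith [dist_triangle4 a w (x (θ k) t) (z t)]

end STLBarrier
end

/-! ### Measurability, cut-off and continuation of solutions. -/

noncomputable section

/-- Stopping an absolutely continuous curve keeps it absolutely continuous. -/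
theorem AbsolutelyContinuousOnInterval.comp_min {X : Type*} [PseudoMetricSpace X] {f : ℝ → X}
    {a b c : ℝ} (hf : AbsolutelyContinuousOnInterval f a b) (hab : a ≤ b) (hbc : b ≤ c) :
    AbsolutelyContinuousOnInterval (fun t => f (min t b)) a c := by
  rw [absolutelyContinuousOnInterval_iff] at hf ⊢
  intro ε hε
  obtain ⟨δ, hδ, h⟩ := hf ε hε
  refine ⟨δ, hδ, fun E hE hlen => ?_⟩
  refine h (E.1, fun i => (min (E.2 i).1 b, min (E.2 i).2 b)) ⟨fun i hi => ?_, ?_⟩ ?_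
  · obtain ⟨h1, h2⟩ := hE.1 i hi
    rw [uIcc_of_le (hab.trans hbc)] at h1 h2
    rw [uIcc_of_le hab]
    exact ⟨⟨le_min h1.1 hab, min_le_right _ _⟩, ⟨le_min h2.1 hab, min_le_right _ _⟩⟩
  · refine hE.2.mono fun i => ?_
    intro t ht
    simp only [uIoc, mem_Ioc] at ht ⊢
    grind
  · refine (Finset.sum_le_sum fun i _ => ?_).trans_lt hlen
    exact (LipschitzWith.id.min_const b).dist_le_mul _ _ |>.trans (by simp)

namespace STLBarrier

theorem filippovMap_congr {n : ℕ} {v w : Vec n → ℝ → Vec n} {x : Vec n} {t r : ℝ} (hr : 0 < r)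
    (h : ∀ y ∈ Metric.ball x r, v y t = w y t) : filippovMap v x t ⊆ filippovMap w x t := by
  intro ζ hζ
  simp only [filippovMap, mem_iInter] at hζ ⊢
  intro δ hδ N hN
  refine closure_mono (convexHull_mono ?_) (hζ (min δ r) (lt_min hδ hr) N hN)
  rintro _ ⟨y, ⟨hy, hyN⟩, rfl⟩
  exact ⟨y, ⟨Metric.ball_subset_ball (min_le_left _ _) hy, hyN⟩,
    (h y (Metric.ball_subset_ball (min_le_right _ _) hy)).symm⟩

theorem LocBounded.exists_bound {n : ℕ} {F : Type} [NormedAddCommGroup F]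
    {v : Vec n → ℝ → F} (hv : LocBounded v) {K : Set (Vec n × ℝ)} (hK : IsCompact K)
    (hsub : K ⊆ univ ×ˢ Ici 0) : ∃ M : NNReal, ∀ p ∈ K, ‖v p.1 p.2‖ ≤ M := by
  refine hK.induction_on (p := fun S => ∃ M : NNReal, ∀ p ∈ S, ‖v p.1 p.2‖ ≤ M) ⟨0, by simp⟩
    (fun s t hst ⟨M, hM⟩ => ⟨M, fun p hp => hM p (hst hp)⟩) ?_ ?_
  · rintro s t ⟨M, hM⟩ ⟨M', hM'⟩
    refine ⟨max M M', fun p hp => ?_⟩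
    rw [NNReal.coe_max]
    rcases hp with hp | hp
    · exact (hM p hp).trans (le_max_left _ _)
    · exact (hM' p hp).trans (le_max_right _ _)
  · rintro ⟨y, t⟩ hyt
    obtain ⟨M, hM⟩ := hv y t (hsub hyt).2
    exact ⟨_, nhdsWithin_mono _ hsub hM, M.toNNReal, fun p (hp : ‖v p.1 p.2‖ ≤ M) =>
      hp.trans (Real.le_coe_toNNReal M)⟩

/-- A function that is continuous in the first and Lebesgue measurable in the second argument is
jointly Lebesgue measurable. -/
theorem SufficientlyRegular.lebesgueMeasurable {n : ℕ} {F : Type} [NormedAddCommGroup F]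
    [MeasurableSpace F] [BorelSpace F] [SecondCountableTopology F] {v : Vec n → ℝ → F}
    (hv : SufficientlyRegular v) : LebesgueMeasurable v := by
  classical
  set w : Vec n → ℝ → F := fun y t => if 0 ≤ t then v y t else 0 with hw
  have hwc : ∀ t, Continuous fun y => w y t := fun t => by
    by_cases ht : 0 ≤ t
    · simpa [hw, ht] using (hv.1 t ht).continuous
    · simpa [hw, ht] using continuous_const
  have hwm : ∀ y, NullMeasurable (w y) (volume.restrict (Ici (0 : ℝ))) := fun y => by
    refine ((hv.2 y).congr ?_).nullMeasurable
    filter_upwards [ae_restrict_mem measurableSet_Ici] with t ht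
    simp only [hw, if_pos (mem_Ici.1 ht)]
  -- The exceptional null set in time depends on `y`. Taking the null-measurable sets as σ-algebra
  -- on the time axis makes each `w y` measurable outright.
  have hjoint := measurable_uncurry_of_continuous_of_measurable
    (α := NullMeasurableSpace ℝ (volume.restrict (Ici (0 : ℝ)))) (u := w) hwc hwm
  have hprod : (volume : Measure (Vec n × ℝ)).restrict (univ ×ˢ Ici 0) =
      (volume : Measure (Vec n)).prod (volume.restrict (Ici (0 : ℝ))) := by
    rw [Measure.volume_eq_prod, ← Measure.prod_restrict, Measure.restrict_univ]
  have hwnull : NullMeasurable (fun p : Vec n × ℝ => w p.1 p.2)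
      (volume.restrict (univ ×ˢ Ici 0)) := by
    rw [hprod]
    intro S hS
    have hfst : Measurable (fun p : NullMeasurableSpace (Vec n × ℝ)
        ((volume : Measure (Vec n)).prod (volume.restrict (Ici (0 : ℝ)))) => (p.1 : Vec n)) :=
      fun A hA => (measurable_fst hA).nullMeasurableSet
    have hsnd : Measurable (β := NullMeasurableSpace ℝ (volume.restrict (Ici (0 : ℝ))))
        (fun p : NullMeasurableSpace (Vec n × ℝ)
        ((volume : Measure (Vec n)).prod (volume.restrict (Ici (0 : ℝ)))) => p.2) :=
      fun A hA => NullMeasurableSet.preimage (μb := volume.restrict (Ici (0 : ℝ)))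
        (show NullMeasurableSet (α := ℝ) A _ from hA) Measure.quasiMeasurePreserving_snd
    have h1 := Measurable.prodMk
      (γ := NullMeasurableSpace ℝ (volume.restrict (Ici (0 : ℝ)))) hfst hsnd
    exact h1 (hjoint hS)
  refine hwnull.aemeasurable.congr ?_
  filter_upwards [ae_restrict_mem (MeasurableSet.univ.prod measurableSet_Ici)] with p hp
  simp only [hw, if_pos (mem_Ici.1 hp.2)]

theorem Formula.IsSwitchingSequence.exists_mem_Ico {n : ℕ} {φ : Formula n} {q : ℕ} {s : ℕ → ℝ}
    (hs : φ.IsSwitchingSequence q s) {t : ℝ} (ht : t ∈ Ico 0 (s q)) :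
    ∃ j < q, t ∈ Ico (s j) (s (j + 1)) := by
  have h : ∀ i, t < s i → ∃ j < i, t ∈ Ico (s j) (s (j + 1)) := by
    intro i
    induction i with
    | zero =>
      intro h
      rw [hs.zero] at h
      exact absurd ht.1 h.not_ge
    | succ i ih =>
      intro h
      rcases lt_or_ge t (s i) with h1 | h1
      · obtain ⟨j, hj, hjt⟩ := ih h1
        exact ⟨j, hj.trans i.lt_succ_self, hjt⟩
      · exact ⟨i, i.lt_succ_self, h1, h⟩
  exact h q ht.2

/-- A Filippov solution can be continued, as long as it stays in a given ball, by a curve that is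
defined on an arbitrarily long interval. -/
theorem exists_continuation {n : ℕ} {v : Vec n → ℝ → Vec n} (hmeas : LebesgueMeasurable v)
    (hbdd : LocBounded v) {x : ℝ → Vec n} {t₁ T : ℝ} (ht₁ : 0 ≤ t₁) (hT : t₁ ≤ T)
    (hx : IsFilippovSolution v x 0 t₁) (R : ℝ) :
    ∃ z : ℝ → Vec n, EqOn z x (Icc 0 t₁) ∧ AbsolutelyContinuousOnInterval z 0 T ∧
      ∀ᵐ t, t ∈ Icc 0 T → z t ∈ Metric.ball 0 R → ∃ ζ ∈ filippovMap v (z t) t,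
        HasDerivAt z ζ t := by
  classical
  obtain ⟨M, hM⟩ := hbdd.exists_bound
    ((isCompact_closedBall (0 : Vec n) R).prod (isCompact_Icc (a := (0 : ℝ)) (b := T)))
    (prod_mono (subset_univ _) fun t ht => ht.1)
  set A : Set (Vec n × ℝ) := Metric.ball 0 R ×ˢ Icc 0 T with hA
  have hAm : MeasurableSet A := measurableSet_ball.prod measurableSet_Icc
  -- Bounded and measurable everywhere, with the same Filippov map as `v` at points of the open
  -- ball, since that map depends only on values near the point.
  set w : Vec n → ℝ → Vec n := fun y t => A.indicator (fun p => v p.1 p.2) (y, t) with hw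
  have hwM : ∀ y t, ‖w y t‖ ≤ M := fun y t => by
    simp only [hw, indicator]
    split_ifs with h
    · exact hM (y, t) ⟨Metric.ball_subset_closedBall h.1, h.2⟩
    · simp
  have hwm : AEStronglyMeasurable (fun p : Vec n × ℝ => w p.1 p.2) volume := by
    refine (aestronglyMeasurable_indicator_iff hAm).2 ?_
    exact hmeas.aestronglyMeasurable.mono_measure
      (Measure.restrict_mono (prod_mono (subset_univ _) fun t ht => ht.1) le_rfl)
  obtain ⟨y, hy0, hyM, hy⟩ := exists_filippov_solution hwM hwm t₁ (x t₁)
  -- The curve `x` stopped at `t₁` plus the increment of `y` after `t₁`: absolute continuity of the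
  -- glued curve reduces to that of a sum.
  set z : ℝ → Vec n := fun t => x (min t t₁) + (y (max t t₁) - x t₁) with hz
  have hleft : ∀ t ≤ t₁, z t = x t := fun t ht => by
    simp only [hz, min_eq_left ht, max_eq_right ht, hy0, sub_self, add_zero]
  have hright : ∀ t, t₁ ≤ t → z t = y t := fun t ht => by
    simp only [hz, min_eq_right ht, max_eq_left ht, add_sub_cancel]
  refine ⟨z, fun t ht => hleft t ht.2, ?_, ?_⟩
  · refine (hx.1.comp_min ht₁ hT).fun_add (LipschitzOnWith.absolutelyContinuousOnInterval
      (K := M) (LipschitzWith.lipschitzOnWith ?_))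
    refine LipschitzWith.of_dist_le_mul fun a b => ?_
    rw [dist_sub_right]
    exact (hyM.dist_le_mul _ _).trans (mul_le_mul_of_nonneg_left
      (((LipschitzWith.id.max_const t₁).dist_le_mul a b).trans (by simp)) M.coe_nonneg)
  · have hx2 := (ae_restrict_iff' measurableSet_Icc).1 hx.2
    filter_upwards [hx2, hy, Measure.ae_ne volume t₁] with t hxt hyt hne ht hball
    rcases lt_or_gt_of_ne hne with hlt | hlt
    · obtain ⟨ζ, hζ, hd⟩ := hxt ⟨ht.1, hlt.le⟩
      rw [hleft t hlt.le]
      refine ⟨ζ, hζ, hd.congr_of_eventuallyEq ?_⟩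
      filter_upwards [Iio_mem_nhds hlt] with τ hτ using hleft τ (mem_Iio.1 hτ).le
    · obtain ⟨ζ, hζ, hd⟩ := hyt hlt.le
      rw [hright t hlt.le] at hball ⊢
      refine ⟨ζ, ?_, hd.congr_of_eventuallyEq ?_⟩
      · obtain ⟨r, hr, hrsub⟩ := Metric.isOpen_iff.1 Metric.isOpen_ball _ hball
        refine filippovMap_congr hr (fun a ha => ?_) hζ
        exact indicator_of_mem (s := A) (show (a, t) ∈ A from ⟨hrsub ha, ht⟩) _
      · filter_upwards [Ioi_mem_nhds hlt] with τ hτ using hright τ (mem_Ioi.1 hτ).le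

end STLBarrier
end

/-! ### The main theorem. -/

theorem corollary1 {n m k : ℕ}
    -- the formula and the convention for the until operator
    (φ : STLBarrier.Formula n) (σ : STLBarrier.UntilStart)
    -- the system `ẋ = f(x,t) + g(x,t) u(x,t) + c(x,t)`
    (f : STLBarrier.Vec n → ℝ → STLBarrier.Vec n)
    (g : STLBarrier.Vec n → ℝ → (STLBarrier.Vec m →L[ℝ] STLBarrier.Vec n))
    (c : STLBarrier.Vec n → ℝ → STLBarrier.Vec n)
    (u : STLBarrier.Vec n → ℝ → STLBarrier.Vec m)
    (hf : STLBarrier.SufficientlyRegular f)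
    (hg : STLBarrier.SufficientlyRegular g)
    (hc : STLBarrier.SufficientlyRegular c)
    (C : ℝ) (hC : 0 ≤ C) (hcC : ∀ x t, 0 ≤ t → ‖c x t‖ ≤ C)
    (hu_bdd : STLBarrier.LocBounded u) (hu_meas : STLBarrier.LebesgueMeasurable u)
    -- the switching times
    (q : ℕ) (s : ℕ → ℝ) (hs : φ.IsSwitchingSequence q s)
    -- the function `𝔟`
    (η : ℝ) (hη : 0 < η)
    (β : φ.Idx → STLBarrier.Vec n → ℝ → ℝ) (γ : Fin k → STLBarrier.Vec n → ℝ → ℝ)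
    (hβ : ∀ l, ContinuousOn (fun p : STLBarrier.Vec n × ℝ => β l p.1 p.2) (univ ×ˢ Ici 0))
    (hγ : ∀ i, ContinuousOn (fun p : STLBarrier.Vec n × ℝ => γ i p.1 p.2) (univ ×ˢ Ici 0))
    (hsteps : φ.Steps σ β)
    (b : STLBarrier.Vec n → ℝ → ℝ) (hb : b = STLBarrier.barrier φ η β γ)
    (hb_smooth : ∀ j < q, ContDiffOn ℝ 1 (fun p : STLBarrier.Vec n × ℝ => b p.1 p.2)
      (univ ×ˢ Ioo (s j) (s (j + 1))))
    (hb_cand : ∀ j < q, STLBarrier.IsCandidateCBF b (s j) (s (j + 1)))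
    -- the open sets `𝔇` and the compact sets `𝔇'`
    (D D' : ℕ → Set (STLBarrier.Vec n))
    (hD_open : ∀ j < q, IsOpen (D j)) (hD'_compact : ∀ j < q, IsCompact (D' j))
    (hD'D : ∀ j < q, D' j ⊆ D j)
    (hsafe : ∀ j < q, ∀ t ∈ Ico (s j) (s (j + 1)), STLBarrier.safeSet b t ⊆ D' j)
    -- the barrier inequality
    (α : ℕ → ℝ → ℝ) (hα : ∀ j < q, STLBarrier.IsExtendedClassK (α j))
    (hα_lip : ∀ j < q, LocallyLipschitz (α j))
    (hineq : ∀ j < q, ∀ x ∈ D j, ∀ t ∈ Ioo (s j) (s (j + 1)),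
      ∀ r ∈ STLBarrier.lieDerivative (fun y τ => f y τ + g y τ (u y τ)) b x t,
        -(α j (b x t)) + ‖fderiv ℝ (fun y => b y t) x‖ * C ≤ r) :
    ∀ (x : ℝ → STLBarrier.Vec n) (t₁ : ℝ), 0 ≤ t₁ →
      STLBarrier.IsFilippovSolution (fun y τ => f y τ + g y τ (u y τ) + c y τ) x 0 t₁ →
      x 0 ∈ STLBarrier.safeSet b 0 →
      -- a solution that is defined up to the last switching time satisfies the formula
      (s q ≤ t₁ → φ.Sat σ x) ∧
      -- and every solution can be continued up to the last switching time
      (STLBarrier.LocBounded (fun y τ => f y τ + g y τ (u y τ) + c y τ) →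
        ∃ (x' : ℝ → STLBarrier.Vec n) (t₂ : ℝ), t₁ ≤ t₂ ∧ s q ≤ t₂ ∧ EqOn x' x (Icc 0 t₁) ∧
          STLBarrier.IsFilippovSolution (fun y τ => f y τ + g y τ (u y τ) + c y τ) x' 0 t₂ ∧
          φ.Sat σ x') := by
  subst hb
  set v : STLBarrier.Vec n → ℝ → STLBarrier.Vec n := fun y τ => f y τ + g y τ (u y τ) + c y τ
  -- forward invariance, for curves that solve the inclusion while they are in `U`
  have invariance : ∀ U : Set (STLBarrier.Vec n), IsOpen U → (∀ j < q, D' j ⊆ U) →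
      ∀ (x : ℝ → STLBarrier.Vec n) (T : ℝ), 0 ≤ T → AbsolutelyContinuousOnInterval x 0 T →
      (∀ᵐ t, t ∈ Icc 0 T → x t ∈ U → ∃ ζ ∈ STLBarrier.filippovMap v (x t) t, HasDerivAt x ζ t) →
      x 0 ∈ STLBarrier.safeSet (STLBarrier.barrier φ η β γ) 0 →
      ∀ t ∈ Icc 0 T, t < s q → 0 ≤ STLBarrier.barrier φ η β γ (x t) t := by
    intro U hU hD'U x T hT hx hsol h0
    refine hs.barrier_nonneg hη hβ hγ hb_smooth (D := fun j => D j ∩ U)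
      (fun j hj => (hD_open j hj).inter hU)
      (fun j hj t ht y hy => ⟨hD'D j hj (hsafe j hj t ht hy), hD'U j hj (hsafe j hj t ht hy)⟩)
      hT hx (fun j hj => ?_) h0
    filter_upwards [hsol] with t ht htT htj hxD hneg
    obtain ⟨ζ, hζ, hd⟩ := ht htT hxD.2
    have hα0 : α j (STLBarrier.barrier φ η β γ (x t) t) ≤ 0 := by
      rw [← (hα j hj).2.2]
      exact (hα j hj).2.1.monotone hneg.le
    exact ⟨ζ, hd, STLBarrier.nonneg_of_lieDerivative (hc.1 t htT.1).continuous.continuousAt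
      (hcC _ _ htT.1) hζ hα0 (hineq j hj _ hxD.1 t htj)⟩
  have sat : ∀ (x : ℝ → STLBarrier.Vec n) (T : ℝ), s q ≤ T →
      STLBarrier.IsFilippovSolution v x 0 T →
      x 0 ∈ STLBarrier.safeSet (STLBarrier.barrier φ η β γ) 0 → φ.Sat σ x := by
    intro x T hqT hx h0
    have hT : 0 ≤ T := (hs.nonneg le_rfl).trans hqT
    have hxc : ContinuousOn x (Icc 0 T) := by simpa [uIcc_of_le hT] using hx.1.continuousOn
    have hsol := (ae_restrict_iff' measurableSet_Icc).1 hx.2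
    refine hs.sat_of_barrier_nonneg hη hβ hsteps (hxc.mono (Icc_subset_Icc_right hqT))
      fun t ht => invariance univ isOpen_univ (fun j _ => subset_univ _) x T hT hx.1
        ?_ h0 t ⟨ht.1, ht.2.le.trans hqT⟩ ht.2
    filter_upwards [hsol] with t ht htT _ using ht htT
  intro x t₁ ht₁ hx h0
  refine ⟨fun hq => sat x t₁ hq hx h0, fun hbdd => ?_⟩
  rcases le_or_gt (s q) t₁ with hq | hq
  · exact ⟨x, t₁, le_rfl, hq, fun _ _ => rfl, hx, sat x t₁ hq hx h0⟩
  have hgu : STLBarrier.LebesgueMeasurable (fun y τ => g y τ (u y τ)) :=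
    ((continuous_fst.clm_apply continuous_snd).comp_aestronglyMeasurable
      (hg.lebesgueMeasurable.aestronglyMeasurable.prodMk hu_meas.aestronglyMeasurable)).aemeasurable
  have hv_meas : STLBarrier.LebesgueMeasurable v :=
    (hf.lebesgueMeasurable.add hgu).add hc.lebesgueMeasurable
  obtain ⟨R, hR⟩ : ∃ R : ℝ, ∀ j < q, D' j ⊆ Metric.ball 0 R := by
    have hbound : Bornology.IsBounded (⋃ j ∈ Iio q, D' j) :=
      (Bornology.isBounded_biUnion (finite_Iio q)).2 fun j hj => (hD'_compact j hj).isBounded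
    obtain ⟨R, hR⟩ := hbound.subset_ball 0
    exact ⟨R, fun j hj => (subset_biUnion_of_mem (mem_Iio.2 hj)).trans hR⟩
  obtain ⟨z, hzx, hzac, hzsol⟩ :=
    STLBarrier.exists_continuation hv_meas hbdd ht₁ hq.le hx R
  have hsq : 0 ≤ s q := hs.nonneg le_rfl
  have hz0 : z 0 ∈ STLBarrier.safeSet (STLBarrier.barrier φ η β γ) 0 := by
    rwa [hzx ⟨le_rfl, ht₁⟩]
  -- There is no circularity: the inclusion is used only while `z` is in the ball, and `b ≥ 0` then
  -- places `z t` in some `D' j`, hence in the ball.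
  have hinv := invariance (Metric.ball 0 R) Metric.isOpen_ball hR z (s q) hsq hzac hzsol hz0
  have hz : STLBarrier.IsFilippovSolution v z 0 (s q) := by
    refine ⟨hzac, (ae_restrict_iff' measurableSet_Icc).2 ?_⟩
    -- Invariance is available only before `s q`; the single time `s q` is negligible.
    filter_upwards [hzsol, Measure.ae_ne volume (s q)] with t ht hne htq
    have hlt : t < s q := htq.2.lt_of_ne hne
    obtain ⟨j, hj, htj⟩ := hs.exists_mem_Ico ⟨htq.1, hlt⟩
    exact ht htq (hR j hj (hsafe j hj t htj (hinv t htq hlt)))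
  exact ⟨z, s q, hq.le, le_rfl, hzx, hz, sat z (s q) le_rfl hz hz0⟩
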